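/- **Conventions.** Let $\square$ be the subcategory of the category of posets whose objects are the powers $[1]^n$ ($n\ge 0$) of $[1]=\{0<1\}$ and whose morphisms are generated under composition by the faces $\partial_{i,\varepsilon}$ (insert $\varepsilon\in\{0,1\}$ at coordinate $i$), the degeneracies $\sigma_i$ (forget coordinate $i$) and the negative connections (replace the coordinates $i,i+1$ by their maximum). A cubical set is a presheaf on $\square$; $\square^n$ is the presheaf represented by $[1]^n$, and $S_0$ is the set of vertices of $S$. A double pointed cubical set $S_{a,b}$ is a cubical set $S$ with $a,b\in S_0$, and $c\mathcal{S}et_{*,*}$ is the category of these; $\square^n$ is double pointed by its least and greatest vertices. For double pointed $X_{a,b}$, $Y_{c,d}$, let $X\vee Y$ be the pushout that identifies $b$ with $c$, pointed by $a$ and $d$; two maps $f:X\to Z_{u,v}$ and $g:Y\to Z_{v,w}$ induce $f*g:X\vee Y\to Z_{u,w}$. A necklace is a double pointed cubical set $\square^{n_1}\vee\dots\vee\square^{n_k}$ with $k\ge 0$ and all $n_i\geq 1$ ($\square^0$ for $k=0$), and $\mathcal{N}ec$ is the full subcategory of $c\mathcal{S}et_{*,*}$ on the necklaces. Write $I_n=\square^1\vee\dots\vee\square^1$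 ($n$ factors). For a cubical set $S$ let $\mathfrak{C}_{path}(S)$ be the following category enriched in preordered sets. Its set of objects is $S_0$. Its morphisms from $a$ to $b$ are the maps $I_n\to S_{a,b}$, $n\ge 0$, modulo the equivalence relation generated by $\gamma\sim\gamma'$ whenever $\gamma$ is the composite of $\gamma'$ with some double pointed map $I_n\to I_m$. Composition is concatenation $(\gamma,\gamma')\mapsto\gamma*\gamma'$. The preorder is the reflexive transitive closure of the relation $[f\circ s]\rightsquigarrow[f\circ t]$ for $f:I_k\vee\square^2\vee I_r\to S_{a,b}$, where $s=\mathrm{id}\vee(\partial_{1,0}*\partial_{2,1})\vee\mathrm{id}$ and $t=\mathrm{id}\vee(\partial_{2,0}*\partial_{1,1})\vee\mathrm{id}$. Applying the nerve $N$ to the morphism preorders gives a simplicial category $N\mathfrak{C}_{path}(S)$. The rigidification functor $\mathfrak{C}^\square:c\mathcal{S}et\to s\mathcal{C}at$ is the left Kan extension of $[1]^n\mapsto N\mathfrak{C}_{path}(\square^n)$ along the Yoneda embedding $\square\to c\mathcal{S}et$. The set of objects of $\mathfrak{C}^\square(S)$ is $S_0$. Let $\mathfrak{C}^\square_t:c\mathcal{S}et_{*,*}\to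 s\mathcal{S}et$ be the functor $S_{a,b}\mapsto\mathfrak{C}^\square(S)(a,b)$. **Theorem.** For every cubical set $S$ and all $a,b\in S_0$ there is an isomorphism of simplicial sets $$\operatorname*{colim}_{(T\to S_{a,b})\in\mathcal{N}ec\downarrow S_{a,b}}\mathfrak{C}^\square_t(T)\;\cong\;\mathfrak{C}^\square(S)(a,b)=\mathfrak{C}^\square_t(S_{a,b}),$$ natural in $S_{a,b}\in c\mathcal{S}et_{*,*}$, whose restriction to the summand $\mathfrak{C}^\square_t(T)$ of $f:T\to S_{a,b}$ is $\mathfrak{C}^\square_t(f)$. -/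

import Mathlib

open CategoryTheory Opposite Limits

universe u

namespace CubRig

/-! ### The category of cubes -/

/-- The face `∂_{i,ε} : [1]ⁿ → [1]ⁿ⁺¹`, inserting `ε` at the coordinate `i`. -/
def face {n : ℕ} (i : Fin (n + 1)) (ε : Bool) (x : Fin n → Bool) : Fin (n + 1) → Bool :=
  i.insertNth (α := fun _ => Bool) ε x

/-- The degeneracy `σ_i : [1]ⁿ⁺¹ → [1]ⁿ`, forgetting the coordinate `i`. -/
def degen {n : ℕ} (i : Fin (n + 1)) (x : Fin (n + 1) → Bool) : Fin n → Bool :=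
  fun j => x (i.succAbove j)

/-- The negative connection `γ_{i,0} : [1]ⁿ⁺¹ → [1]ⁿ`, replacing the coordinates `i` and `i + 1`
by their maximum. -/
def conn {n : ℕ} (i : Fin n) (x : Fin (n + 1) → Bool) : Fin n → Bool :=
  fun j => if j < i then x j.castSucc else if j = i then max (x j.castSucc) (x j.succ)
    else x j.succ

/-- The maps `[1]ᵐ → [1]ⁿ` generated under composition by faces, degeneracies and
negative connections. -/
inductive IsBoxMap : ∀ {m n : ℕ}, ((Fin m → Bool) → (Fin n → Bool)) → Prop
  | id (n : ℕ) : IsBoxMap (fun x : Fin n → Bool => x)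
  | comp {l m n : ℕ} {f : (Fin l → Bool) → (Fin m → Bool)} {g : (Fin m → Bool) → (Fin n → Bool)} :
      IsBoxMap f → IsBoxMap g → IsBoxMap (fun x => g (f x))
  | face {n : ℕ} (i : Fin (n + 1)) (ε : Bool) : IsBoxMap (face i ε)
  | degen {n : ℕ} (i : Fin (n + 1)) : IsBoxMap (degen i)
  | conn {n : ℕ} (i : Fin n) : IsBoxMap (conn i)

/-- The category `□`: an object `⟨n⟩` stands for the poset `[1]ⁿ`. -/
structure Box : Type where
  /-- the dimension -/
  dim : ℕ

/-- Morphisms of `□`. -/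
@[ext]
structure Box.Hom (m n : Box) : Type where
  /-- the underlying map of vertices -/
  toFun : (Fin m.dim → Bool) → (Fin n.dim → Bool)
  isBoxMap : IsBoxMap toFun

instance : Category Box where
  Hom := Box.Hom
  id n := ⟨fun x => x, .id _⟩
  comp f g := ⟨fun x => g.toFun (f.toFun x), .comp f.isBoxMap g.isBoxMap⟩

lemma isBoxMap_vertex : ∀ {n : ℕ} (v : Fin n → Bool), IsBoxMap (fun _ : Fin 0 → Bool => v)
  | 0, v => by
    have : (fun _ : Fin 0 → Bool => v) = fun x => x := by
      funext x; exact Subsingleton.elim _ _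
    rw [this]; exact .id 0
  | n + 1, v => by
    have h := IsBoxMap.comp (isBoxMap_vertex (Fin.tail v)) (IsBoxMap.face 0 (v 0))
    have e : (fun _ : Fin 0 → Bool => v) = fun _ => face 0 (v 0) (Fin.tail v) := by
      funext _
      simp [face]
    rw [e]; exact h

/-- The vertex `v` of `[1]ⁿ`, as a map `[1]⁰ → [1]ⁿ`. -/
def Box.vertex {n : ℕ} (v : Fin n → Bool) : (⟨0⟩ : Box) ⟶ ⟨n⟩ :=
  ⟨fun _ => v, isBoxMap_vertex v⟩

/-- The face maps as morphisms of `□`. -/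
def Box.face {n : ℕ} (i : Fin (n + 1)) (ε : Bool) : (⟨n⟩ : Box) ⟶ ⟨n + 1⟩ :=
  ⟨CubRig.face i ε, .face i ε⟩

/-! ### Cubical sets -/

/-- Cubical sets (with negative connections). -/
abbrev CSet : Type (u + 1) := Boxᵒᵖ ⥤ Type u

/-- The Yoneda embedding `□ ⥤ cSet`. -/
abbrev yo : Box ⥤ CSet.{u} := uliftYoneda.{u}

/-- The `n`-cube `□ⁿ`. -/
abbrev cube (n : ℕ) : CSet.{u} := yo.{u}.obj ⟨n⟩

/-- The set `S₀` of vertices of a cubical set. -/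
abbrev CSet.Vertex (S : CSet.{u}) : Type u := S.obj (op ⟨0⟩)

/-- The vertex `f(a)`. -/
abbrev CSet.onVertex {S S' : CSet.{u}} (f : S ⟶ S') (a : CSet.Vertex S) : CSet.Vertex S' :=
  f.app (op ⟨0⟩) a

/-- A vertex as a map `□⁰ → S`. -/
def CSet.pt {S : CSet.{u}} (a : CSet.Vertex S) : cube.{u} 0 ⟶ S := uliftYonedaEquiv.{u}.symm a

/-- The vertex of `□ⁿ` given by an element of `[1]ⁿ`. -/
def cubeVertex {n : ℕ} (v : Fin n → Bool) : CSet.Vertex (cube.{u} n) := ⟨Box.vertex v⟩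

/-- The unique vertex of `□⁰`. -/
abbrev star : CSet.Vertex (cube.{u} 0) := ⟨𝟙 _⟩

lemma CSet.pt_comp {S S' : CSet.{u}} (a : CSet.Vertex S) (f : S ⟶ S') :
    CSet.pt a ≫ f = CSet.pt (CSet.onVertex f a) :=
  uliftYonedaEquiv_symm_comp a f

lemma CSet.onVertex_pt {S : CSet.{u}} (a : CSet.Vertex S) : CSet.onVertex (CSet.pt a) star = a :=
  uliftYonedaEquiv.{u}.apply_symm_apply a

lemma vertex_cube_zero (x : CSet.Vertex (cube.{u} 0)) : x = star := by
  obtain ⟨x⟩ := x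
  congr 1
  apply Box.Hom.ext
  funext v
  exact Subsingleton.elim _ _

lemma CSet.cube_zero_hom_ext {S : CSet.{u}} {f g : cube.{u} 0 ⟶ S}
    (h : CSet.onVertex f star = CSet.onVertex g star) : f = g :=
  uliftYonedaEquiv.{u}.injective h

/-! ### Double pointed cubical sets and concatenation -/

/-- A double pointed cubical set `S_{a,b}`. -/
structure BiCSet : Type (u + 1) where
  /-- the cubical set -/
  S : CSet.{u}
  /-- the first base vertex -/
  a : CSet.Vertex S
  /-- the second base vertex -/
  b : CSet.Vertex S

/-- Maps of double pointed cubical sets. -/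
@[ext]
structure BiCSet.Hom (X Y : BiCSet.{u}) : Type u where
  /-- the underlying map -/
  hom : X.S ⟶ Y.S
  map_a : CSet.onVertex hom X.a = Y.a
  map_b : CSet.onVertex hom X.b = Y.b

instance : Category BiCSet.{u} where
  Hom := BiCSet.Hom
  id X := ⟨𝟙 _, rfl, rfl⟩
  comp f g := ⟨f.hom ≫ g.hom,
    (congrArg (CSet.onVertex g.hom) f.map_a).trans g.map_a,
    (congrArg (CSet.onVertex g.hom) f.map_b).trans g.map_b⟩

namespace BiCSet

@[ext]
lemma hom_ext {X Y : BiCSet.{u}} {f g : X ⟶ Y} (h : f.hom = g.hom) : f = g := BiCSet.Hom.ext h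

@[simp] lemma id_hom (X : BiCSet.{u}) : BiCSet.Hom.hom (𝟙 X) = 𝟙 X.S := rfl

@[simp] lemma comp_hom {X Y Z : BiCSet.{u}} (f : X ⟶ Y) (g : Y ⟶ Z) :
    (f ≫ g).hom = f.hom ≫ g.hom := rfl

/-- The `n`-cube, double pointed by its least and its greatest vertex. -/
abbrev cube (n : ℕ) : BiCSet.{u} :=
  ⟨CubRig.cube n, cubeVertex fun _ => false, cubeVertex fun _ => true⟩

/-- The concatenation product `X ∨ Y`, identifying the second base vertex of `X` with the first
base vertex of `Y`. -/
noncomputable def wedge (X Y : BiCSet.{u}) : BiCSet.{u} where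
  S := pushout (CSet.pt X.b) (CSet.pt Y.a)
  a := CSet.onVertex (pushout.inl _ _) X.a
  b := CSet.onVertex (pushout.inr _ _) Y.b

/-- The inclusion of `X` in `X ∨ Y`. -/
noncomputable def inl (X Y : BiCSet.{u}) : X.S ⟶ (wedge X Y).S := pushout.inl _ _

/-- The inclusion of `Y` in `X ∨ Y`. -/
noncomputable def inr (X Y : BiCSet.{u}) : Y.S ⟶ (wedge X Y).S := pushout.inr _ _

lemma glue (X Y : BiCSet.{u}) : CSet.onVertex (inl X Y) X.b = CSet.onVertex (inr X Y) Y.a := by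
  have h : CSet.pt X.b ≫ inl X Y = CSet.pt Y.a ≫ inr X Y := pushout.condition
  rw [CSet.pt_comp, CSet.pt_comp] at h
  exact uliftYonedaEquiv.{u}.symm.injective h

lemma wedge_hom_ext {X Y : BiCSet.{u}} {Z : CSet.{u}} {f g : (wedge X Y).S ⟶ Z}
    (h₁ : inl X Y ≫ f = inl X Y ≫ g) (h₂ : inr X Y ≫ f = inr X Y ≫ g) : f = g :=
  pushout.hom_ext h₁ h₂

/-- The map out of `X ∨ Y` given by two maps that agree at the gluing vertex. -/
noncomputable def glueMap {X Y : BiCSet.{u}} {Z : CSet.{u}} (f : X.S ⟶ Z) (g : Y.S ⟶ Z)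
    (h : CSet.onVertex f X.b = CSet.onVertex g Y.a) : (wedge X Y).S ⟶ Z :=
  pushout.desc f g (by rw [CSet.pt_comp, CSet.pt_comp, h])

@[simp]
lemma inl_glueMap {X Y : BiCSet.{u}} {Z : CSet.{u}} (f : X.S ⟶ Z) (g : Y.S ⟶ Z)
    (h : CSet.onVertex f X.b = CSet.onVertex g Y.a) : inl X Y ≫ glueMap f g h = f :=
  pushout.inl_desc _ _ _

@[simp]
lemma inr_glueMap {X Y : BiCSet.{u}} {Z : CSet.{u}} (f : X.S ⟶ Z) (g : Y.S ⟶ Z)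
    (h : CSet.onVertex f X.b = CSet.onVertex g Y.a) : inr X Y ≫ glueMap f g h = g :=
  pushout.inr_desc _ _ _

@[simp]
lemma inl_glueMap_assoc {X Y : BiCSet.{u}} {Z W : CSet.{u}} (f : X.S ⟶ Z) (g : Y.S ⟶ Z)
    (h : CSet.onVertex f X.b = CSet.onVertex g Y.a) (k : Z ⟶ W) :
    inl X Y ≫ glueMap f g h ≫ k = f ≫ k := by
  rw [← Category.assoc, inl_glueMap]

@[simp]
lemma inr_glueMap_assoc {X Y : BiCSet.{u}} {Z W : CSet.{u}} (f : X.S ⟶ Z) (g : Y.S ⟶ Z)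
    (h : CSet.onVertex f X.b = CSet.onVertex g Y.a) (k : Z ⟶ W) :
    inr X Y ≫ glueMap f g h ≫ k = g ≫ k := by
  rw [← Category.assoc, inr_glueMap]

lemma glueMap_a {X Y : BiCSet.{u}} {Z : CSet.{u}} (f : X.S ⟶ Z) (g : Y.S ⟶ Z)
    (h : CSet.onVertex f X.b = CSet.onVertex g Y.a) :
    CSet.onVertex (glueMap f g h) (wedge X Y).a = CSet.onVertex f X.a :=
  congrArg (fun k => CSet.onVertex k X.a) (inl_glueMap f g h)

lemma glueMap_b {X Y : BiCSet.{u}} {Z : CSet.{u}} (f : X.S ⟶ Z) (g : Y.S ⟶ Z)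
    (h : CSet.onVertex f X.b = CSet.onVertex g Y.a) :
    CSet.onVertex (glueMap f g h) (wedge X Y).b = CSet.onVertex g Y.b :=
  congrArg (fun k => CSet.onVertex k Y.b) (inr_glueMap f g h)

/-- The map `f * g : X ∨ Y → Z_{u,w}` induced by `f : X → Z_{u,v}` and `g : Y → Z_{v,w}`. -/
noncomputable def desc {X Y : BiCSet.{u}} {Z : CSet.{u}} {u v w : CSet.Vertex Z}
    (f : X ⟶ ⟨Z, u, v⟩) (g : Y ⟶ ⟨Z, v, w⟩) : wedge X Y ⟶ ⟨Z, u, w⟩ where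
  hom := glueMap f.hom g.hom (id (f.map_b.trans g.map_a.symm))
  map_a := (glueMap_a _ _ _).trans f.map_a
  map_b := (glueMap_b _ _ _).trans g.map_b

@[simp]
lemma desc_hom {X Y : BiCSet.{u}} {Z : CSet.{u}} {u v w : CSet.Vertex Z}
    (f : X ⟶ ⟨Z, u, v⟩) (g : Y ⟶ ⟨Z, v, w⟩) :
    (desc f g).hom = glueMap f.hom g.hom (id (f.map_b.trans g.map_a.symm)) := rfl

/-- A map `S → S'`, as a double pointed map `S_{a,b} → S'_{f(a),f(b)}`. -/
def ofMap {S S' : CSet.{u}} (f : S ⟶ S') (a b : CSet.Vertex S) :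
    (⟨S, a, b⟩ : BiCSet.{u}) ⟶ ⟨S', CSet.onVertex f a, CSet.onVertex f b⟩ :=
  ⟨f, rfl, rfl⟩

@[simp] lemma ofMap_hom {S S' : CSet.{u}} (f : S ⟶ S') (a b : CSet.Vertex S) :
    (ofMap f a b).hom = f := rfl

/-- The map `f ∨ g : X ∨ Y → X' ∨ Y'`. -/
noncomputable def wedgeMap {X X' Y Y' : BiCSet.{u}} (f : X ⟶ X') (g : Y ⟶ Y') :
    wedge X Y ⟶ wedge X' Y' where
  hom := glueMap (f.hom ≫ inl X' Y') (g.hom ≫ inr X' Y')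
    (id <| ((congrArg (CSet.onVertex (inl X' Y')) f.map_b).trans (glue X' Y')).trans
      (congrArg (CSet.onVertex (inr X' Y')) g.map_a.symm))
  map_a := (glueMap_a _ _ _).trans (congrArg (CSet.onVertex (inl X' Y')) f.map_a)
  map_b := (glueMap_b _ _ _).trans (congrArg (CSet.onVertex (inr X' Y')) g.map_b)

lemma wedgeMap_desc {X X' Y Y' : BiCSet.{u}} {Z : CSet.{u}} {u v w : CSet.Vertex Z}
    (f : X ⟶ X') (g : Y ⟶ Y') (h : X' ⟶ ⟨Z, u, v⟩) (k : Y' ⟶ ⟨Z, v, w⟩) :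
    wedgeMap f g ≫ desc h k = desc (f ≫ h) (g ≫ k) := by
  apply hom_ext
  apply wedge_hom_ext <;> simp [wedgeMap]

lemma wedgeMap_id (X Y : BiCSet.{u}) : wedgeMap (𝟙 X) (𝟙 Y) = 𝟙 _ := by
  apply hom_ext
  apply wedge_hom_ext <;> simp [wedgeMap]

lemma wedgeMap_comp {X X' X'' Y Y' Y'' : BiCSet.{u}} (f : X ⟶ X') (f' : X' ⟶ X'')
    (g : Y ⟶ Y') (g' : Y' ⟶ Y'') : wedgeMap f g ≫ wedgeMap f' g' = wedgeMap (f ≫ f') (g ≫ g') := by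
  apply hom_ext
  apply wedge_hom_ext <;> simp [wedgeMap]

/-- Functoriality of `∨` on isomorphisms. -/
noncomputable def wedgeIso {X X' Y Y' : BiCSet.{u}} (f : X ≅ X') (g : Y ≅ Y') :
    wedge X Y ≅ wedge X' Y' where
  hom := wedgeMap f.hom g.hom
  inv := wedgeMap f.inv g.inv
  hom_inv_id := by rw [wedgeMap_comp, f.hom_inv_id, g.hom_inv_id, wedgeMap_id]
  inv_hom_id := by rw [wedgeMap_comp, f.inv_hom_id, g.inv_hom_id, wedgeMap_id]

/-- The associativity isomorphism of `∨`. -/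
noncomputable def assoc (X Y Z : BiCSet.{u}) : wedge (wedge X Y) Z ≅ wedge X (wedge Y Z) where
  hom :=
    { hom := glueMap
        (glueMap (inl X (wedge Y Z)) (inl Y Z ≫ inr X (wedge Y Z))
          (id <| glue X (wedge Y Z)))
        (inr Y Z ≫ inr X (wedge Y Z))
        (id <| (glueMap_b _ _ _).trans
          (congrArg (CSet.onVertex (inr X (wedge Y Z))) (glue Y Z)))
      map_a := (glueMap_a _ _ _).trans (glueMap_a _ _ _)
      map_b := glueMap_b _ _ _ }
  inv :=
    { hom := glueMap (inl X Y ≫ inl (wedge X Y) Z)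
        (glueMap (inr X Y ≫ inl (wedge X Y) Z) (inr (wedge X Y) Z)
          (id <| glue (wedge X Y) Z))
        (by
          refine id (Eq.trans ?_ (glueMap_a _ _ _).symm)
          exact congrArg (CSet.onVertex (inl (wedge X Y) Z)) (glue X Y))
      map_a := glueMap_a _ _ _
      map_b := (glueMap_b _ _ _).trans (glueMap_b _ _ _) }
  hom_inv_id := by
    apply hom_ext
    apply wedge_hom_ext
    · apply wedge_hom_ext <;> simp
    · simp
  inv_hom_id := by
    apply hom_ext
    apply wedge_hom_ext
    · simp
    · apply wedge_hom_ext <;> simp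

lemma assoc_hom_desc {X Y Z : BiCSet.{u}} {W : CSet.{u}} {a b c d : CSet.Vertex W}
    (f : X ⟶ ⟨W, a, b⟩) (g : Y ⟶ ⟨W, b, c⟩) (h : Z ⟶ ⟨W, c, d⟩) :
    (assoc X Y Z).hom ≫ desc f (desc g h) = desc (desc f g) h := by
  apply hom_ext
  apply wedge_hom_ext
  · apply wedge_hom_ext <;> simp [assoc]
  · simp [assoc]

/-- The one-point necklace `□⁰`, the unit of `∨`. -/
abbrev unit : BiCSet.{u} := ⟨CubRig.cube 0, star, star⟩

/-- The constant path at a vertex. -/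
def const {S : CSet.{u}} (a : CSet.Vertex S) : unit.{u} ⟶ ⟨S, a, a⟩ :=
  ⟨CSet.pt a, CSet.onVertex_pt a, CSet.onVertex_pt a⟩

lemma unit_hom_ext {X : BiCSet.{u}} {f g : unit.{u} ⟶ X} : f = g :=
  hom_ext (CSet.cube_zero_hom_ext (f.map_a.trans g.map_a.symm))

/-- The left unit isomorphism of `∨`. -/
noncomputable def leftUnit (X : BiCSet.{u}) : wedge unit X ≅ X where
  hom :=
    { hom := glueMap (X := unit) (CSet.pt X.a) (𝟙 X.S) (id <| CSet.onVertex_pt X.a)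
      map_a := (glueMap_a _ _ _).trans (CSet.onVertex_pt X.a)
      map_b := glueMap_b _ _ _ }
  inv := ⟨inr unit X, (glue unit X).symm, rfl⟩
  hom_inv_id := by
    apply hom_ext
    apply wedge_hom_ext
    · apply CSet.cube_zero_hom_ext
      rw [comp_hom, inl_glueMap_assoc]
      exact (congrArg (CSet.onVertex (inr unit X)) (CSet.onVertex_pt X.a)).trans
        (glue unit X).symm
    · simp
  inv_hom_id := by
    apply hom_ext
    simp

/-- The right unit isomorphism of `∨`. -/
noncomputable def rightUnit (X : BiCSet.{u}) : wedge X unit ≅ X where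
  hom :=
    { hom := glueMap (Y := unit) (𝟙 X.S) (CSet.pt X.b) (id <| (CSet.onVertex_pt X.b).symm)
      map_a := glueMap_a _ _ _
      map_b := (glueMap_b _ _ _).trans (CSet.onVertex_pt X.b) }
  inv := ⟨inl X unit, rfl, glue X unit⟩
  hom_inv_id := by
    apply hom_ext
    apply wedge_hom_ext
    · simp
    · apply CSet.cube_zero_hom_ext
      rw [comp_hom, inr_glueMap_assoc]
      exact (congrArg (CSet.onVertex (inl X unit)) (CSet.onVertex_pt X.b)).trans
        (glue X unit)
  inv_hom_id := by
    apply hom_ext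
    simp

end BiCSet

/-! ### Necklaces -/

open BiCSet

/-- The necklace `□^{n₁} ∨ ⋯ ∨ □^{n_k}` of a sequence of positive integers. -/
noncomputable def neck : List ℕ+ → BiCSet.{u}
  | [] => BiCSet.unit
  | n :: l => wedge (BiCSet.cube n) (neck l)

/-- The category of necklaces, a full subcategory of double pointed cubical sets. -/
abbrev Nec : Type := InducedCategory BiCSet.{u} neck.{u}

/-- The inclusion of necklaces in double pointed cubical sets. -/
noncomputable abbrev necIncl : Nec.{u} ⥤ BiCSet.{u} := inducedFunctor neck.{u}

/-! ### The path category of a cubical set -/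

/-- The necklace `I_n` with `n` beads of dimension one. -/
noncomputable def spine (n : ℕ) : BiCSet.{u} := neck (List.replicate n 1)

/-- Maps `I_n → S_{a,b}`, for all `n`. -/
abbrev RawPath (S : CSet.{u}) (a b : CSet.Vertex S) : Type u :=
  Σ n : ℕ, (spine.{u} n ⟶ (⟨S, a, b⟩ : BiCSet.{u}))

/-- `γ` factors through `γ'` by a double pointed map `I_n → I_m`. -/
def RawPath.Rel {S : CSet.{u}} {a b : CSet.Vertex S} (γ γ' : RawPath S a b) : Prop :=
  ∃ φ : spine.{u} γ.1 ⟶ spine.{u} γ'.1, γ.2 = φ ≫ γ'.2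

/-- The set of paths in `S` joining `a` to `b`: the quotient by the equivalence relation
generated by `RawPath.Rel`. -/
def CPath (S : CSet.{u}) (a b : CSet.Vertex S) : Type u := Quot (@RawPath.Rel S a b)

/-- `X` is isomorphic to some `I_n`. -/
abbrev IsSpine (X : BiCSet.{u}) : Prop := ∃ n, Nonempty (spine.{u} n ≅ X)

/-- The path represented by a map out of a double pointed cubical set that is isomorphic to
some `I_n`; it does not depend on the isomorphism. -/
noncomputable def CPath.mk {X : BiCSet.{u}} (hX : IsSpine X) {S : CSet.{u}} {a b : CSet.Vertex S}
    (f : X ⟶ ⟨S, a, b⟩) : CPath S a b :=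
  Quot.mk _ ⟨hX.choose, hX.choose_spec.some.hom ≫ f⟩

lemma CPath.mk_comp {X Y : BiCSet.{u}} (hX : IsSpine X) (hY : IsSpine Y) {S : CSet.{u}}
    {a b : CSet.Vertex S} (h : X ⟶ Y) (f : Y ⟶ ⟨S, a, b⟩) :
    CPath.mk hX (h ≫ f) = CPath.mk hY f :=
  Quot.sound ⟨hX.choose_spec.some.hom ≫ h ≫ hY.choose_spec.some.inv, by simp⟩

lemma isSpine_spine (n : ℕ) : IsSpine (spine.{u} n) := ⟨n, ⟨Iso.refl _⟩⟩

lemma CPath.quot_mk_eq {S : CSet.{u}} {a b : CSet.Vertex S} (n : ℕ)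
    (f : spine.{u} n ⟶ ⟨S, a, b⟩) :
    (Quot.mk _ ⟨n, f⟩ : CPath S a b) = CPath.mk (isSpine_spine n) f :=
  Quot.sound ⟨(isSpine_spine n).choose_spec.some.inv, by simp⟩

lemma CPath.ind {S : CSet.{u}} {a b : CSet.Vertex S} {P : CPath S a b → Prop}
    (h : ∀ (n : ℕ) (f : spine.{u} n ⟶ ⟨S, a, b⟩), P (CPath.mk (isSpine_spine n) f))
    (p : CPath S a b) : P p := by
  obtain ⟨⟨n, f⟩⟩ := p
  rw [CPath.quot_mk_eq]
  exact h n f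

lemma isSpine_unit : IsSpine BiCSet.unit.{u} := ⟨0, ⟨Iso.refl _⟩⟩

lemma isSpine_edge : IsSpine (BiCSet.cube.{u} 1) := ⟨1, ⟨rightUnit _⟩⟩

lemma isSpine_wedge_spine (m : ℕ) : ∀ n, IsSpine (wedge (spine.{u} n) (spine.{u} m))
  | 0 => ⟨m, ⟨(leftUnit _).symm⟩⟩
  | n + 1 => by
    obtain ⟨k, ⟨e⟩⟩ := isSpine_wedge_spine m n
    exact ⟨k + 1, ⟨wedgeIso (Iso.refl _) e ≪≫ (assoc _ _ _).symm⟩⟩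

lemma IsSpine.wedge {X Y : BiCSet.{u}} (hX : IsSpine X) (hY : IsSpine Y) :
    IsSpine (BiCSet.wedge X Y) := by
  obtain ⟨n, ⟨e⟩⟩ := hX
  obtain ⟨m, ⟨e'⟩⟩ := hY
  obtain ⟨k, ⟨e''⟩⟩ := isSpine_wedge_spine.{u} m n
  exact ⟨k, ⟨e'' ≪≫ wedgeIso e e'⟩⟩

/-- The constant path. -/
noncomputable def CPath.const {S : CSet.{u}} (a : CSet.Vertex S) : CPath S a a :=
  CPath.mk isSpine_unit (BiCSet.const a)

/-- Concatenation of paths, induced by `(γ, β) ↦ γ * β`. -/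
noncomputable def CPath.concat {S : CSet.{u}} {a b c : CSet.Vertex S} (p : CPath S a b)
    (q : CPath S b c) : CPath S a c :=
  Quot.liftOn₂ p q
    (fun γ β => CPath.mk ((isSpine_spine γ.1).wedge (isSpine_spine β.1)) (desc γ.2 β.2))
    (by
      rintro ⟨n, γ⟩ ⟨m, β⟩ ⟨m', β'⟩ ⟨φ, h⟩
      dsimp at φ h ⊢
      rw [← CPath.mk_comp _ _ (wedgeMap (𝟙 _) φ) (desc γ β'), wedgeMap_desc, ← h, Category.id_comp])
    (by
      rintro ⟨n, γ⟩ ⟨n', γ'⟩ ⟨m, β⟩ ⟨φ, h⟩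
      dsimp at φ h ⊢
      rw [← CPath.mk_comp _ _ (wedgeMap φ (𝟙 _)) (desc γ' β), wedgeMap_desc, ← h, Category.id_comp])

lemma CPath.concat_mk {X Y : BiCSet.{u}} (hX : IsSpine X) (hY : IsSpine Y) {S : CSet.{u}}
    {a b c : CSet.Vertex S} (f : X ⟶ ⟨S, a, b⟩) (g : Y ⟶ ⟨S, b, c⟩) :
    (CPath.mk hX f).concat (CPath.mk hY g) = CPath.mk (hX.wedge hY) (desc f g) := by
  change CPath.mk ((isSpine_spine _).wedge (isSpine_spine _)) (desc (_ ≫ f) (_ ≫ g)) = _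
  rw [← wedgeMap_desc, CPath.mk_comp _ (hX.wedge hY)]

/-- The image of a path under a map of cubical sets. -/
noncomputable def CPath.map {S S' : CSet.{u}} (h : S ⟶ S') {a b : CSet.Vertex S} (p : CPath S a b) :
    CPath S' (CSet.onVertex h a) (CSet.onVertex h b) :=
  Quot.map (fun γ => ⟨γ.1, γ.2 ≫ ofMap h a b⟩)
    (by
      rintro γ γ' ⟨φ, e⟩
      exact ⟨φ, by simp [e]⟩) p

lemma CPath.map_mk {X : BiCSet.{u}} (hX : IsSpine X) {S S' : CSet.{u}} (h : S ⟶ S')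
    {a b : CSet.Vertex S} (f : X ⟶ ⟨S, a, b⟩) :
    (CPath.mk hX f).map h = CPath.mk hX (f ≫ ofMap h a b) := by
  change Quot.mk _ (⟨_, (_ ≫ f) ≫ ofMap h a b⟩ : RawPath _ _ _) = Quot.mk _ _
  rw [Category.assoc]

lemma CPath.const_concat {S : CSet.{u}} {a b : CSet.Vertex S} (p : CPath S a b) :
    (CPath.const a).concat p = p := by
  induction p using CPath.ind with
  | h n f =>
    rw [CPath.const, CPath.concat_mk, ← CPath.mk_comp (isSpine_spine n) (isSpine_unit.wedge (isSpine_spine n))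
      (leftUnit _).inv]
    congr 1
    apply hom_ext
    simp [leftUnit]

lemma CPath.concat_const {S : CSet.{u}} {a b : CSet.Vertex S} (p : CPath S a b) :
    p.concat (CPath.const b) = p := by
  induction p using CPath.ind with
  | h n f =>
    rw [CPath.const, CPath.concat_mk, ← CPath.mk_comp (isSpine_spine n) ((isSpine_spine n).wedge isSpine_unit)
      (rightUnit _).inv]
    congr 1
    apply hom_ext
    simp [rightUnit]

lemma CPath.concat_assoc {S : CSet.{u}} {a b c d : CSet.Vertex S} (p : CPath S a b)
    (q : CPath S b c) (r : CPath S c d) : (p.concat q).concat r = p.concat (q.concat r) := by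
  induction p using CPath.ind with
  | h n f =>
  induction q using CPath.ind with
  | h m g =>
  induction r using CPath.ind with
  | h k h =>
    rw [CPath.concat_mk, CPath.concat_mk, CPath.concat_mk, CPath.concat_mk, ← assoc_hom_desc,
      CPath.mk_comp]

lemma CPath.map_const {S S' : CSet.{u}} (h : S ⟶ S') (a : CSet.Vertex S) :
    (CPath.const a).map h = CPath.const (CSet.onVertex h a) := by
  rw [CPath.const, CPath.map_mk]
  congr 1
  exact unit_hom_ext

lemma CPath.map_concat {S S' : CSet.{u}} (h : S ⟶ S') {a b c : CSet.Vertex S} (p : CPath S a b)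
    (q : CPath S b c) : (p.concat q).map h = (p.map h).concat (q.map h) := by
  induction p using CPath.ind with
  | h n f =>
  induction q using CPath.ind with
  | h m g =>
    rw [CPath.concat_mk, CPath.map_mk, CPath.map_mk, CPath.map_mk, CPath.concat_mk]
    congr 1
    apply hom_ext
    apply wedge_hom_ext <;> simp

/-- A face of the square, as a double pointed map. -/
def squareFace (i : Fin 2) (ε : Bool) {v w : Fin 2 → Bool}
    (hv : face i ε (fun _ => false) = v) (hw : face i ε (fun _ => true) = w) :
    BiCSet.cube.{u} 1 ⟶ ⟨cube 2, cubeVertex v, cubeVertex w⟩ where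
  hom := yo.map (Box.face i ε)
  map_a := by subst hv; rfl
  map_b := by subst hw; rfl

/-- The path `∂_{1,0} * ∂_{2,1}` of the square, through the vertex `(0,1)`. -/
noncomputable def squareSource :
    wedge (BiCSet.cube.{u} 1) (BiCSet.cube 1) ⟶ BiCSet.cube 2 :=
  desc (v := cubeVertex ![false, true]) (squareFace 0 false (by decide) (by decide))
    (squareFace 1 true (by decide) (by decide))

/-- The path `∂_{2,0} * ∂_{1,1}` of the square, through the vertex `(1,0)`. -/
noncomputable def squareTarget :
    wedge (BiCSet.cube.{u} 1) (BiCSet.cube 1) ⟶ BiCSet.cube 2 :=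
  desc (v := cubeVertex ![true, false]) (squareFace 1 false (by decide) (by decide))
    (squareFace 0 true (by decide) (by decide))

lemma isSpine_step (k r : ℕ) : IsSpine (wedge (spine.{u} k)
    (wedge (wedge (BiCSet.cube 1) (BiCSet.cube 1)) (spine r))) :=
  (isSpine_spine k).wedge ((isSpine_edge.wedge isSpine_edge).wedge (isSpine_spine r))

/-- The elementary relation `[γ] ⇝ [γ']`: there is a map from the necklace `I_k ∨ □² ∨ I_r` to
`S_{a,b}` whose restrictions along `id ∨ (∂_{1,0} * ∂_{2,1}) ∨ id` and
`id ∨ (∂_{2,0} * ∂_{1,1}) ∨ id` represent the two paths. -/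
def CPath.Step {S : CSet.{u}} {a b : CSet.Vertex S} (p q : CPath S a b) : Prop :=
  ∃ (k r : ℕ) (f : wedge (spine.{u} k) (wedge (BiCSet.cube 2) (spine r)) ⟶ ⟨S, a, b⟩),
    p = CPath.mk (isSpine_step k r) (wedgeMap (𝟙 _) (wedgeMap squareSource (𝟙 _)) ≫ f) ∧
    q = CPath.mk (isSpine_step k r) (wedgeMap (𝟙 _) (wedgeMap squareTarget (𝟙 _)) ≫ f)

/-- The preorder on paths: the reflexive transitive closure of the elementary relation. -/
instance {S : CSet.{u}} (a b : CSet.Vertex S) : Preorder (CPath S a b) where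
  le := Relation.ReflTransGen CPath.Step
  le_refl _ := Relation.ReflTransGen.refl
  le_trans _ _ _ := Relation.ReflTransGen.trans

lemma BiCSet.wedgeMap_assoc_inv {X X' Y Y' Z Z' : BiCSet.{u}} (f : X ⟶ X') (g : Y ⟶ Y') (h : Z ⟶ Z') :
    wedgeMap f (wedgeMap g h) ≫ (assoc X' Y' Z').inv = (assoc X Y Z).inv ≫ wedgeMap (wedgeMap f g) h := by
  apply hom_ext
  apply wedge_hom_ext
  · simp [wedgeMap, assoc]
  · apply wedge_hom_ext <;> simp [wedgeMap, assoc]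

lemma BiCSet.wedgeMap_assoc_hom {X X' Y Y' Z Z' : BiCSet.{u}} (f : X ⟶ X') (g : Y ⟶ Y') (h : Z ⟶ Z') :
    wedgeMap (wedgeMap f g) h ≫ (assoc X' Y' Z').hom = (assoc X Y Z).hom ≫ wedgeMap f (wedgeMap g h) := by
  rw [← Iso.inv_comp_eq, ← Category.assoc, ← wedgeMap_assoc_inv, Category.assoc, Iso.inv_hom_id,
    Category.comp_id]

lemma CPath.Step.concat_right {S : CSet.{u}} {a b c : CSet.Vertex S} {p p' : CPath S a b}
    (h : CPath.Step p p') (q : CPath S b c) : CPath.Step (p.concat q) (p'.concat q) := by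
  obtain ⟨k, r, f, rfl, rfl⟩ := h
  induction q using CPath.ind with
  | h m g =>
  obtain ⟨r', ⟨e⟩⟩ := isSpine_wedge_spine.{u} m r
  have key : ∀ d : wedge (BiCSet.cube.{u} 1) (BiCSet.cube 1) ⟶ BiCSet.cube 2,
      (CPath.mk (isSpine_step k r) (wedgeMap (𝟙 _) (wedgeMap d (𝟙 _)) ≫ f)).concat
        (CPath.mk (isSpine_spine m) g) =
      CPath.mk (isSpine_step k r') (wedgeMap (𝟙 _) (wedgeMap d (𝟙 _)) ≫
        (wedgeMap (𝟙 _) (wedgeMap (𝟙 _) e.hom ≫ (assoc _ _ _).inv) ≫ (assoc _ _ _).inv ≫ desc f g)) := by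
    intro d
    rw [CPath.concat_mk, ← CPath.mk_comp (isSpine_step k r') _
      (wedgeMap (𝟙 _) (wedgeMap (𝟙 _) e.hom ≫ (assoc _ _ _).inv) ≫ (assoc _ _ _).inv)]
    congr 1
    have h1 : desc (wedgeMap (𝟙 (spine.{u} k)) (wedgeMap d (𝟙 (spine.{u} r))) ≫ f) g =
        wedgeMap (wedgeMap (𝟙 (spine.{u} k)) (wedgeMap d (𝟙 (spine.{u} r)))) (𝟙 _) ≫ desc f g := by
      rw [wedgeMap_desc, Category.id_comp]
    rw [h1]
    simp only [← Category.assoc]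
    congr 1
    rw [Category.assoc, ← wedgeMap_assoc_inv, ← Category.assoc, wedgeMap_comp, wedgeMap_comp]
    simp only [Category.assoc]
    rw [← wedgeMap_assoc_inv]
    simp only [← Category.assoc]
    rw [wedgeMap_comp, wedgeMap_comp, wedgeMap_id]
    simp
  exact ⟨k, r', _, key _, key _⟩

lemma CPath.Step.concat_left {S : CSet.{u}} {a b c : CSet.Vertex S} {q q' : CPath S b c}
    (h : CPath.Step q q') (p : CPath S a b) : CPath.Step (p.concat q) (p.concat q') := by
  obtain ⟨k, r, f, rfl, rfl⟩ := h
  induction p using CPath.ind with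
  | h m g =>
  obtain ⟨k', ⟨e⟩⟩ := isSpine_wedge_spine.{u} k m
  have key : ∀ d : wedge (BiCSet.cube.{u} 1) (BiCSet.cube 1) ⟶ BiCSet.cube 2,
      (CPath.mk (isSpine_spine m) g).concat
        (CPath.mk (isSpine_step k r) (wedgeMap (𝟙 _) (wedgeMap d (𝟙 _)) ≫ f)) =
      CPath.mk (isSpine_step k' r) (wedgeMap (𝟙 _) (wedgeMap d (𝟙 _)) ≫
        (wedgeMap e.hom (𝟙 _) ≫ (assoc _ _ _).hom ≫ desc g f)) := by
    intro d
    rw [CPath.concat_mk, ← CPath.mk_comp (isSpine_step k' r) _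
      (wedgeMap e.hom (𝟙 _) ≫ (assoc _ _ _).hom)]
    congr 1
    have h1 : desc g (wedgeMap (𝟙 (spine.{u} k)) (wedgeMap d (𝟙 (spine.{u} r))) ≫ f) =
        wedgeMap (𝟙 _) (wedgeMap (𝟙 (spine.{u} k)) (wedgeMap d (𝟙 (spine.{u} r)))) ≫ desc g f := by
      rw [wedgeMap_desc, Category.id_comp]
    rw [h1]
    simp only [← Category.assoc]
    congr 1
    rw [Category.assoc, ← wedgeMap_assoc_hom, ← Category.assoc, wedgeMap_comp, wedgeMap_comp, wedgeMap_id]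
    simp
  exact ⟨k', r, _, key _, key _⟩

lemma CPath.concat_mono {S : CSet.{u}} {a b c : CSet.Vertex S} {p p' : CPath S a b}
    {q q' : CPath S b c} (hp : p ≤ p') (hq : q ≤ q') : p.concat q ≤ p'.concat q' :=
  Relation.ReflTransGen.trans
    (Relation.ReflTransGen.lift (fun x : CPath S a b => x.concat q)
      (fun _ _ h => CPath.Step.concat_right h q) _ _ hp)
    (Relation.ReflTransGen.lift (fun x : CPath S b c => p'.concat x)
      (fun _ _ h => CPath.Step.concat_left h p') _ _ hq)

lemma CPath.map_mono {S S' : CSet.{u}} (h : S ⟶ S') {a b : CSet.Vertex S} {p p' : CPath S a b}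
    (hp : p ≤ p') : p.map h ≤ p'.map h := by
  refine Relation.ReflTransGen.lift (fun x : CPath S a b => x.map h) ?_ _ _ hp
  rintro _ _ ⟨k, r, f, rfl, rfl⟩
  refine ⟨k, r, f ≫ ofMap h a b, ?_, ?_⟩ <;> exact (CPath.map_mk _ _ _).trans (by rw [Category.assoc])

lemma CPath.map_id {S : CSet.{u}} {a b : CSet.Vertex S} (p : CPath S a b) : p.map (𝟙 S) = p := by
  induction p using CPath.ind with
  | h n f => rw [CPath.map_mk]; rfl

lemma CPath.map_comp {S S' S'' : CSet.{u}} (h : S ⟶ S') (h' : S' ⟶ S'') {a b : CSet.Vertex S}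
    (p : CPath S a b) : p.map (h ≫ h') = (p.map h).map h' := by
  induction p using CPath.ind with
  | h n f => rw [CPath.map_mk, CPath.map_mk, CPath.map_mk]; rfl

/-! ### Simplicial categories -/

open EnrichedCategory MonoidalCategory

/-- Small simplicial categories, i.e. categories enriched in simplicial sets. -/
structure SCat : Type (u + 1) where
  /-- the type of objects -/
  Obj : Type u
  [str : EnrichedCategory SSet.{u} Obj]

attribute [instance] SCat.str

instance : Category SCat.{u} where
  Hom C D := EnrichedFunctor SSet.{u} C.Obj D.Obj
  id C := EnrichedFunctor.id _ C.Obj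
  comp F G := EnrichedFunctor.comp _ F G
  id_comp _ := rfl
  comp_id _ := rfl
  assoc _ _ _ := rfl

namespace SCat

/-- The simplicial set of morphisms. -/
abbrev hom (C : SCat.{u}) (x y : C.Obj) : SSet.{u} := x ⟶[SSet.{u}] y

/-- The identity of `x`, as a `Δ`-simplex. -/
def one (C : SCat.{u}) (x : C.Obj) (Δ : SimplexCategoryᵒᵖ) : (C.hom x x).obj Δ :=
  (eId SSet.{u} x).app Δ PUnit.unit

/-- Composition of `Δ`-simplices. -/
def mul (C : SCat.{u}) {x y z : C.Obj} {Δ : SimplexCategoryᵒᵖ} (f : (C.hom x y).obj Δ)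
    (g : (C.hom y z).obj Δ) : (C.hom x z).obj Δ :=
  (eComp SSet.{u} x y z).app Δ (f, g)

variable (C D : SCat.{u})

lemma one_mul {x y : C.Obj} {Δ : SimplexCategoryᵒᵖ} (f : (C.hom x y).obj Δ) :
    C.mul (C.one x Δ) f = f :=
  ConcreteCategory.congr_hom (NatTrans.congr_app (e_id_comp SSet.{u} x y) Δ) f

lemma mul_one {x y : C.Obj} {Δ : SimplexCategoryᵒᵖ} (f : (C.hom x y).obj Δ) :
    C.mul f (C.one y Δ) = f :=
  ConcreteCategory.congr_hom (NatTrans.congr_app (e_comp_id SSet.{u} x y) Δ) f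

lemma mul_assoc {x y z w : C.Obj} {Δ : SimplexCategoryᵒᵖ} (f : (C.hom x y).obj Δ)
    (g : (C.hom y z).obj Δ) (h : (C.hom z w).obj Δ) :
    C.mul (C.mul f g) h = C.mul f (C.mul g h) :=
  congrArg (fun t : (C.hom x y ⊗ C.hom y z ⊗ C.hom z w) ⟶ C.hom x w => t.app Δ (f, g, h))
    (e_assoc SSet.{u} x y z w)

lemma map_one (x : C.Obj) {Δ Δ' : SimplexCategoryᵒᵖ} (θ : Δ ⟶ Δ') :
    (C.hom x x).map θ (C.one x Δ) = C.one x Δ' :=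
  (ConcreteCategory.congr_hom ((eId SSet.{u} x).naturality θ) PUnit.unit).symm

lemma map_mul {x y z : C.Obj} {Δ Δ' : SimplexCategoryᵒᵖ} (θ : Δ ⟶ Δ') (f : (C.hom x y).obj Δ)
    (g : (C.hom y z).obj Δ) :
    (C.hom x z).map θ (C.mul f g) = C.mul ((C.hom x y).map θ f) ((C.hom y z).map θ g) :=
  (congrArg (fun t : (C.hom x y ⊗ C.hom y z).obj Δ ⟶ (C.hom x z).obj Δ' => t (f, g))
    ((eComp SSet.{u} x y z).naturality θ)).symm

variable {C D}

/-- The value of a simplicial functor on simplices. -/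
def mapSimplex (F : C ⟶ D) {x y : C.Obj} {Δ : SimplexCategoryᵒᵖ} (f : (C.hom x y).obj Δ) :
    (D.hom (F.obj x) (F.obj y)).obj Δ :=
  (F.map x y).app Δ f

lemma mapSimplex_one (F : C ⟶ D) (x : C.Obj) (Δ : SimplexCategoryᵒᵖ) :
    mapSimplex F (C.one x Δ) = D.one (F.obj x) Δ :=
  ConcreteCategory.congr_hom (NatTrans.congr_app (F.map_id x) Δ) PUnit.unit

lemma mapSimplex_mul (F : C ⟶ D) {x y z : C.Obj} {Δ : SimplexCategoryᵒᵖ} (f : (C.hom x y).obj Δ)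
    (g : (C.hom y z).obj Δ) :
    mapSimplex F (C.mul f g) = D.mul (mapSimplex F f) (mapSimplex F g) :=
  congrArg (fun t : (C.hom x y ⊗ C.hom y z) ⟶ D.hom (F.obj x) (F.obj z) => t.app Δ (f, g))
    (F.map_comp x y z)

lemma mapSimplex_map (F : C ⟶ D) {x y : C.Obj} {Δ Δ' : SimplexCategoryᵒᵖ} (θ : Δ ⟶ Δ')
    (f : (C.hom x y).obj Δ) :
    mapSimplex F ((C.hom x y).map θ f) = (D.hom _ _).map θ (mapSimplex F f) :=
  ConcreteCategory.congr_hom ((F.map x y).naturality θ) f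

/-- A simplicial functor given by its values on simplices. -/
def homMk (o : C.Obj → D.Obj)
    (m : ∀ {x y : C.Obj} (Δ : SimplexCategoryᵒᵖ), (C.hom x y).obj Δ → (D.hom (o x) (o y)).obj Δ)
    (m_nat : ∀ {x y : C.Obj} {Δ Δ' : SimplexCategoryᵒᵖ} (θ : Δ ⟶ Δ') (f : (C.hom x y).obj Δ),
      m Δ' ((C.hom x y).map θ f) = (D.hom _ _).map θ (m Δ f))
    (m_one : ∀ (x : C.Obj) (Δ : SimplexCategoryᵒᵖ), m Δ (C.one x Δ) = D.one (o x) Δ)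
    (m_mul : ∀ {x y z : C.Obj} {Δ : SimplexCategoryᵒᵖ} (f : (C.hom x y).obj Δ)
      (g : (C.hom y z).obj Δ), m Δ (C.mul f g) = D.mul (m Δ f) (m Δ g)) : C ⟶ D where
  obj := o
  map x y :=
    { app Δ := ↾fun f => m Δ f
      naturality Δ Δ' θ := by ext f; exact m_nat θ f }
  map_id x := by ext Δ f; exact m_one x Δ
  map_comp x y z := by ext Δ f; exact m_mul f.1 f.2

end SCat

/-- A simplicial category given by its simplicial sets of morphisms and by unit and composition of
simplices. -/
abbrev enrichedOfSimplices (O : Type u) (H : O → O → SSet.{u})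
    (i : ∀ (x : O) (Δ : SimplexCategoryᵒᵖ), (H x x).obj Δ)
    (c : ∀ {x y z : O} (Δ : SimplexCategoryᵒᵖ), (H x y).obj Δ → (H y z).obj Δ → (H x z).obj Δ)
    (i_nat : ∀ (x : O) {Δ Δ' : SimplexCategoryᵒᵖ} (θ : Δ ⟶ Δ'), (H x x).map θ (i x Δ) = i x Δ')
    (c_nat : ∀ {x y z : O} {Δ Δ' : SimplexCategoryᵒᵖ} (θ : Δ ⟶ Δ') (f : (H x y).obj Δ)
      (g : (H y z).obj Δ), (H x z).map θ (c Δ f g) = c Δ' ((H x y).map θ f) ((H y z).map θ g))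
    (i_c : ∀ {x y : O} {Δ : SimplexCategoryᵒᵖ} (f : (H x y).obj Δ), c Δ (i x Δ) f = f)
    (c_i : ∀ {x y : O} {Δ : SimplexCategoryᵒᵖ} (f : (H x y).obj Δ), c Δ f (i y Δ) = f)
    (c_c : ∀ {x y z w : O} {Δ : SimplexCategoryᵒᵖ} (f : (H x y).obj Δ) (g : (H y z).obj Δ)
      (h : (H z w).obj Δ), c Δ (c Δ f g) h = c Δ f (c Δ g h)) :
    EnrichedCategory SSet.{u} O where
  Hom := H
  id x := { app Δ := ↾fun _ => i x Δ, naturality Δ Δ' θ := by ext; exact (i_nat x θ).symm }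
  comp x y z :=
    { app Δ := ↾fun p => c Δ p.1 p.2,
      naturality Δ Δ' θ := by ext p; exact (c_nat θ p.1 p.2).symm }
  id_comp x y := by ext Δ f; exact i_c f
  comp_id x y := by ext Δ f; exact c_i f
  assoc x y z w := by ext Δ f; exact (c_c f.1 f.2.1 f.2.2)

lemma preorder_functor_ext {J P : Type*} [Category* J] [Preorder P] {F G : J ⥤ P}
    (h : ∀ j, F.obj j = G.obj j) : F = G :=
  CategoryTheory.Functor.ext h (fun _ _ _ => Subsingleton.elim _ _)

/-- The simplicial category whose objects are the vertices of `S` and whose simplicial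
sets of morphisms are the nerves of the preordered sets of paths. -/
noncomputable def pathCat (S : CSet.{u}) : SCat.{u} where
  Obj := CSet.Vertex S
  str := enrichedOfSimplices (CSet.Vertex S) (fun a b => nerve (CPath S a b))
    (fun a _ => (Functor.const _).obj (CPath.const a))
    (fun _ F G =>
      { obj := fun i => (F.obj i).concat (G.obj i)
        map := fun f => homOfLE (CPath.concat_mono (leOfHom (F.map f)) (leOfHom (G.map f))) })
    (fun _ _ _ _ => rfl)
    (fun _ _ _ => rfl)
    (fun _ => preorder_functor_ext (fun _ => CPath.const_concat _))
    (fun _ => preorder_functor_ext (fun _ => CPath.concat_const _))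
    (fun _ _ _ => preorder_functor_ext (fun _ => CPath.concat_assoc _ _ _))

/-- The functor `S ↦ pathCat S`. -/
noncomputable def pathFunctor : CSet.{u} ⥤ SCat.{u} where
  obj := pathCat
  map {S S'} h := SCat.homMk (C := pathCat S) (D := pathCat S') (fun a => CSet.onVertex h a)
    (fun {a b : CSet.Vertex S} _ (F : ComposableArrows (CPath S a b) _) =>
      ({ obj := fun i => (F.obj i).map h
         map := fun f => homOfLE (CPath.map_mono h (leOfHom (F.map f))) } :
        ComposableArrows (CPath S' (CSet.onVertex h a) (CSet.onVertex h b)) _))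
    (fun _ _ => rfl)
    (fun _ _ => preorder_functor_ext (fun _ => CPath.map_const h _))
    (fun _ _ => preorder_functor_ext (fun _ => CPath.map_concat h _ _))
  map_id S := by
    refine EnrichedFunctor.ext _ (fun _ => rfl) (fun (a b : CSet.Vertex S) => ?_)
    ext Δ F
    exact preorder_functor_ext (P := CPath S a b) (fun _ => CPath.map_id _)
  map_comp {S S' S''} h h' := by
    refine EnrichedFunctor.ext _ (fun _ => rfl) (fun (a b : CSet.Vertex S) => ?_)
    ext Δ F
    exact preorder_functor_ext
      (P := CPath S'' (CSet.onVertex h' (CSet.onVertex h a)) (CSet.onVertex h' (CSet.onVertex h b)))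
      (fun _ => CPath.map_comp h h' _)

/-- The functor `□ ⥤ sCat`, `[1]ⁿ ↦ pathCat (□ⁿ)`, to be extended to cubical sets. -/
noncomputable abbrev cubeCat : Box ⥤ SCat.{u} := yo ⋙ pathFunctor

/-! ### The rigidification of a cubical set -/

/-- Generators of the `Δ`-simplices of morphisms from `a` to `b`: a cube `x` of `S` with a simplex
of morphisms in `pathCat (□ᵏ)` between vertices `v`, `w` lying over `a` and `b`. -/
structure Gen (S : CSet.{u}) (Δ : SimplexCategoryᵒᵖ) (a b : CSet.Vertex S) : Type u where
  /-- the dimension of the cube -/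
  k : Box
  /-- the cube -/
  x : yo.{u}.obj k ⟶ S
  /-- the source -/
  v : CSet.Vertex (yo.{u}.obj k)
  /-- the target -/
  w : CSet.Vertex (yo.{u}.obj k)
  hv : CSet.onVertex x v = a
  hw : CSet.onVertex x w = b
  /-- the simplex of morphisms -/
  σ : ((cubeCat.obj k).hom v w).obj Δ

/-- The vertices of `S`, as the objects of the quiver of generators. -/
structure Pt (S : CSet.{u}) (Δ : SimplexCategoryᵒᵖ) : Type u where
  /-- the vertex -/
  as : CSet.Vertex S

instance (S : CSet.{u}) (Δ : SimplexCategoryᵒᵖ) : Quiver.{u} (Pt S Δ) :=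
  ⟨fun a b => Gen S Δ a.as b.as⟩

/-- A generator as a morphism of the free category. -/
def Gen.path {S : CSet.{u}} {Δ : SimplexCategoryᵒᵖ} {a b : CSet.Vertex S} (g : Gen S Δ a b) :
    (show Paths (Pt S Δ) from ⟨a⟩) ⟶ (show Paths (Pt S Δ) from ⟨b⟩) :=
  (Paths.of (Pt S Δ)).map (X := ⟨a⟩) (Y := ⟨b⟩) g

/-- The relations: each cube of `S` gives a functor, and these functors are compatible with the
maps of `□`. -/
inductive GenRel (S : CSet.{u}) (Δ : SimplexCategoryᵒᵖ) : HomRel (Paths (Pt S Δ))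
  | one {a : CSet.Vertex S} (k : Box) (x : yo.{u}.obj k ⟶ S) (v : CSet.Vertex (yo.{u}.obj k))
      (hv : CSet.onVertex x v = a) :
      GenRel S Δ (Gen.path ⟨k, x, v, v, hv, hv, (cubeCat.obj k).one v Δ⟩)
        (𝟙 (show Paths (Pt S Δ) from ⟨a⟩))
  | mul {a b c : CSet.Vertex S} (k : Box) (x : yo.{u}.obj k ⟶ S)
      (v w z : CSet.Vertex (yo.{u}.obj k)) (hv : CSet.onVertex x v = a)
      (hw : CSet.onVertex x w = b) (hz : CSet.onVertex x z = c)
      (σ : ((cubeCat.obj k).hom v w).obj Δ) (τ : ((cubeCat.obj k).hom w z).obj Δ) :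
      GenRel S Δ (Gen.path ⟨k, x, v, w, hv, hw, σ⟩ ≫ Gen.path ⟨k, x, w, z, hw, hz, τ⟩)
        (Gen.path ⟨k, x, v, z, hv, hz, (cubeCat.obj k).mul σ τ⟩)
  | nat {a b : CSet.Vertex S} {k k' : Box} (φ : k ⟶ k') (x : yo.{u}.obj k' ⟶ S)
      (v w : CSet.Vertex (yo.{u}.obj k)) (hv : CSet.onVertex (yo.map φ ≫ x) v = a)
      (hw : CSet.onVertex (yo.map φ ≫ x) w = b) (σ : ((cubeCat.obj k).hom v w).obj Δ) :
      GenRel S Δ (Gen.path ⟨k, yo.map φ ≫ x, v, w, hv, hw, σ⟩)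
        (Gen.path ⟨k', x, CSet.onVertex (yo.map φ) v, CSet.onVertex (yo.map φ) w, hv, hw,
          SCat.mapSimplex (cubeCat.map φ) σ⟩)

/-- The category presented by these generators and relations. -/
abbrev Lev (S : CSet.{u}) (Δ : SimplexCategoryᵒᵖ) : Type u := CategoryTheory.Quotient (GenRel S Δ)

/-- A vertex as an object of `Lev S Δ`. -/
abbrev Lev.of {S : CSet.{u}} (Δ : SimplexCategoryᵒᵖ) (a : CSet.Vertex S) : Lev S Δ := ⟨⟨a⟩⟩

/-- The class of a generator. -/
def Gen.cls {S : CSet.{u}} {Δ : SimplexCategoryᵒᵖ} {a b : CSet.Vertex S} (g : Gen S Δ a b) :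
    Lev.of Δ a ⟶ Lev.of Δ b :=
  (CategoryTheory.Quotient.functor (GenRel S Δ)).map g.path

lemma Lev.ind {S : CSet.{u}} {Δ : SimplexCategoryᵒᵖ}
    {P : ∀ {a b : CSet.Vertex S}, (Lev.of Δ a ⟶ Lev.of Δ b) → Prop}
    (h1 : ∀ a, P (𝟙 (Lev.of Δ a)))
    (h2 : ∀ {a b c : CSet.Vertex S} (f : Lev.of Δ a ⟶ Lev.of Δ b) (g : Gen S Δ b c),
      P f → P (f ≫ g.cls))
    {a b : CSet.Vertex S} (f : Lev.of Δ a ⟶ Lev.of Δ b) : P f := by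
  obtain ⟨p⟩ := f
  have key : ∀ (b' : Pt S Δ) (p : @Quiver.Path (Pt S Δ) _ ⟨a⟩ b'),
      P (a := a) (b := b'.as) (Quot.mk _ p) := by
    intro b' p
    induction p with
    | nil => exact h1 a
    | cons p e ih => exact h2 (Quot.mk _ p) e ih
  exact key ⟨b⟩ p

/-- A functor out of `Lev S Δ`, from values on generators that satisfy the relations. -/
def Lev.lift {S : CSet.{u}} {Δ : SimplexCategoryᵒᵖ} {D : Type*} [Category* D]
    (o : CSet.Vertex S → D) (m : ∀ {a b : CSet.Vertex S}, Gen S Δ a b → (o a ⟶ o b))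
    (h_one : ∀ {a : CSet.Vertex S} (k : Box) (x : yo.{u}.obj k ⟶ S)
      (v : CSet.Vertex (yo.{u}.obj k)) (hv : CSet.onVertex x v = a),
      m ⟨k, x, v, v, hv, hv, (cubeCat.obj k).one v Δ⟩ = 𝟙 (o a))
    (h_mul : ∀ {a b c : CSet.Vertex S} (k : Box) (x : yo.{u}.obj k ⟶ S)
      (v w z : CSet.Vertex (yo.{u}.obj k)) (hv : CSet.onVertex x v = a)
      (hw : CSet.onVertex x w = b) (hz : CSet.onVertex x z = c)
      (σ : ((cubeCat.obj k).hom v w).obj Δ) (τ : ((cubeCat.obj k).hom w z).obj Δ),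
      m ⟨k, x, v, w, hv, hw, σ⟩ ≫ m ⟨k, x, w, z, hw, hz, τ⟩ =
        m ⟨k, x, v, z, hv, hz, (cubeCat.obj k).mul σ τ⟩)
    (h_nat : ∀ {a b : CSet.Vertex S} {k k' : Box} (φ : k ⟶ k') (x : yo.{u}.obj k' ⟶ S)
      (v w : CSet.Vertex (yo.{u}.obj k)) (hv : CSet.onVertex (yo.map φ ≫ x) v = a)
      (hw : CSet.onVertex (yo.map φ ≫ x) w = b) (σ : ((cubeCat.obj k).hom v w).obj Δ),
      m ⟨k, yo.map φ ≫ x, v, w, hv, hw, σ⟩ =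
        m ⟨k', x, CSet.onVertex (yo.map φ) v, CSet.onVertex (yo.map φ) w, hv, hw,
          SCat.mapSimplex (cubeCat.map φ) σ⟩) :
    Lev S Δ ⥤ D :=
  CategoryTheory.Quotient.lift _
    (Paths.lift { obj := fun a => o a.as, map := fun g => m g })
    (by
      have key : ∀ {a b : CSet.Vertex S} (g : Gen S Δ a b),
          (Paths.lift (V := Pt S Δ) { obj := fun a => o a.as, map := fun g => m g }).map g.path =
            m g := fun g => Paths.lift_toPath (V := Pt S Δ) _ _
      rintro _ _ _ _ (⟨k, x, v, hv⟩ | ⟨k, x, v, w, z, hv, hw, hz, σ, τ⟩ | ⟨φ, x, v, w, hv, hw, σ⟩)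
      · exact (key _).trans (h_one k x v hv)
      · refine (Functor.map_comp _ _ _).trans ?_
        refine (congrArg₂ (· ≫ ·) (key _) (key _)).trans ?_
        exact (h_mul k x v w z hv hw hz σ τ).trans (key _).symm
      · exact (key _).trans ((h_nat φ x v w hv hw σ).trans (key _).symm))

lemma Lev.lift_cls {S : CSet.{u}} {Δ : SimplexCategoryᵒᵖ} {D : Type*} [Category* D]
    (o : CSet.Vertex S → D) (m : ∀ {a b : CSet.Vertex S}, Gen S Δ a b → (o a ⟶ o b))
    (h_one : ∀ {a : CSet.Vertex S} (k : Box) (x : yo.{u}.obj k ⟶ S)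
      (v : CSet.Vertex (yo.{u}.obj k)) (hv : CSet.onVertex x v = a),
      m ⟨k, x, v, v, hv, hv, (cubeCat.obj k).one v Δ⟩ = 𝟙 (o a))
    (h_mul : ∀ {a b c : CSet.Vertex S} (k : Box) (x : yo.{u}.obj k ⟶ S)
      (v w z : CSet.Vertex (yo.{u}.obj k)) (hv : CSet.onVertex x v = a)
      (hw : CSet.onVertex x w = b) (hz : CSet.onVertex x z = c)
      (σ : ((cubeCat.obj k).hom v w).obj Δ) (τ : ((cubeCat.obj k).hom w z).obj Δ),
      m ⟨k, x, v, w, hv, hw, σ⟩ ≫ m ⟨k, x, w, z, hw, hz, τ⟩ =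
        m ⟨k, x, v, z, hv, hz, (cubeCat.obj k).mul σ τ⟩)
    (h_nat : ∀ {a b : CSet.Vertex S} {k k' : Box} (φ : k ⟶ k') (x : yo.{u}.obj k' ⟶ S)
      (v w : CSet.Vertex (yo.{u}.obj k)) (hv : CSet.onVertex (yo.map φ ≫ x) v = a)
      (hw : CSet.onVertex (yo.map φ ≫ x) w = b) (σ : ((cubeCat.obj k).hom v w).obj Δ),
      m ⟨k, yo.map φ ≫ x, v, w, hv, hw, σ⟩ =
        m ⟨k', x, CSet.onVertex (yo.map φ) v, CSet.onVertex (yo.map φ) w, hv, hw,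
          SCat.mapSimplex (cubeCat.map φ) σ⟩)
    {a b : CSet.Vertex S} (g : Gen S Δ a b) :
    (Lev.lift o m h_one h_mul h_nat).map g.cls = m g :=
  Paths.lift_toPath (V := Pt S Δ) _ _

lemma Gen.cls_one {S : CSet.{u}} {Δ : SimplexCategoryᵒᵖ} {a : CSet.Vertex S} (k : Box)
    (x : yo.{u}.obj k ⟶ S) (v : CSet.Vertex (yo.{u}.obj k)) (hv : CSet.onVertex x v = a) :
    Gen.cls ⟨k, x, v, v, hv, hv, (cubeCat.obj k).one v Δ⟩ = 𝟙 (Lev.of Δ a) :=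
  CategoryTheory.Quotient.sound _ (GenRel.one k x v hv)

lemma Gen.cls_mul {S : CSet.{u}} {Δ : SimplexCategoryᵒᵖ} {a b c : CSet.Vertex S} (k : Box)
    (x : yo.{u}.obj k ⟶ S) (v w z : CSet.Vertex (yo.{u}.obj k)) (hv : CSet.onVertex x v = a)
    (hw : CSet.onVertex x w = b) (hz : CSet.onVertex x z = c)
    (σ : ((cubeCat.obj k).hom v w).obj Δ) (τ : ((cubeCat.obj k).hom w z).obj Δ) :
    Gen.cls ⟨k, x, v, w, hv, hw, σ⟩ ≫ Gen.cls ⟨k, x, w, z, hw, hz, τ⟩ =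
      Gen.cls ⟨k, x, v, z, hv, hz, (cubeCat.obj k).mul σ τ⟩ :=
  CategoryTheory.Quotient.sound _ (GenRel.mul k x v w z hv hw hz σ τ)

lemma Gen.cls_nat {S : CSet.{u}} {Δ : SimplexCategoryᵒᵖ} {a b : CSet.Vertex S} {k k' : Box}
    (φ : k ⟶ k') (x : yo.{u}.obj k' ⟶ S) (v w : CSet.Vertex (yo.{u}.obj k))
    (hv : CSet.onVertex (yo.map φ ≫ x) v = a) (hw : CSet.onVertex (yo.map φ ≫ x) w = b)
    (σ : ((cubeCat.obj k).hom v w).obj Δ) :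
    Gen.cls ⟨k, yo.map φ ≫ x, v, w, hv, hw, σ⟩ =
      Gen.cls ⟨k', x, CSet.onVertex (yo.map φ) v, CSet.onVertex (yo.map φ) w, hv, hw,
        SCat.mapSimplex (cubeCat.map φ) σ⟩ :=
  CategoryTheory.Quotient.sound _ (GenRel.nat φ x v w hv hw σ)

lemma Lev.hom_ext {S : CSet.{u}} {Δ : SimplexCategoryᵒᵖ} {D : Type*} [Category* D]
    {o : CSet.Vertex S → D} (m m' : ∀ {a b : CSet.Vertex S}, (Lev.of Δ a ⟶ Lev.of Δ b) → (o a ⟶ o b))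
    (h_one : ∀ a : CSet.Vertex S, m (𝟙 (Lev.of Δ a)) = 𝟙 (o a))
    (h_mul : ∀ {a b c : CSet.Vertex S} (f : Lev.of Δ a ⟶ Lev.of Δ b) (g : Lev.of Δ b ⟶ Lev.of Δ c),
      m (f ≫ g) = m f ≫ m g)
    (h_one' : ∀ a : CSet.Vertex S, m' (𝟙 (Lev.of Δ a)) = 𝟙 (o a))
    (h_mul' : ∀ {a b c : CSet.Vertex S} (f : Lev.of Δ a ⟶ Lev.of Δ b) (g : Lev.of Δ b ⟶ Lev.of Δ c),
      m' (f ≫ g) = m' f ≫ m' g)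
    (h : ∀ {a b : CSet.Vertex S} (g : Gen S Δ a b), m g.cls = m' g.cls)
    {a b : CSet.Vertex S} (f : Lev.of Δ a ⟶ Lev.of Δ b) : m f = m' f := by
  refine Lev.ind (P := fun f => m f = m' f) (fun a => ?_) (fun f g ih => ?_) f
  · rw [h_one, h_one']
  · rw [h_mul, h_mul', ih, h]

/-- The action of a simplicial operator on generators. -/
noncomputable abbrev Gen.act {S : CSet.{u}} {Δ Δ' : SimplexCategoryᵒᵖ} (θ : Δ ⟶ Δ')
    {a b : CSet.Vertex S} (g : Gen S Δ a b) : Gen S Δ' a b :=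
  ⟨g.k, g.x, g.v, g.w, g.hv, g.hw, ((cubeCat.obj g.k).hom g.v g.w).map θ g.σ⟩

/-- The action of a map of cubical sets on generators. -/
abbrev Gen.map {S S' : CSet.{u}} (h : S ⟶ S') {Δ : SimplexCategoryᵒᵖ}
    {a b : CSet.Vertex S} (g : Gen S Δ a b) :
    Gen S' Δ (CSet.onVertex h a) (CSet.onVertex h b) :=
  ⟨g.k, g.x ≫ h, g.v, g.w, congrArg (CSet.onVertex h) g.hv, congrArg (CSet.onVertex h) g.hw, g.σ⟩

/-- The functor `Lev S Δ ⥤ Lev S Δ'` induced by a simplicial operator. -/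
noncomputable def Lev.act {S : CSet.{u}} {Δ Δ' : SimplexCategoryᵒᵖ} (θ : Δ ⟶ Δ') :
    Lev S Δ ⥤ Lev S Δ' :=
  Lev.lift (fun a => Lev.of Δ' a) (fun g => (g.act θ).cls)
    (fun {a} k x v hv =>
      (congrArg (fun σ => Gen.cls (a := a) (b := a) ⟨k, x, v, v, hv, hv, σ⟩)
        (SCat.map_one (cubeCat.obj k) v θ)).trans (Gen.cls_one k x v hv))
    (fun {a _ c} k x v w z hv hw hz σ τ =>
      (Gen.cls_mul k x v w z hv hw hz _ _).trans
      (congrArg (fun σ => Gen.cls (a := a) (b := c) ⟨k, x, v, z, hv, hz, σ⟩)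
        (SCat.map_mul (cubeCat.obj k) θ σ τ).symm))
    (fun {a b _ k'} φ x v w hv hw σ =>
      (Gen.cls_nat φ x v w hv hw _).trans
      (congrArg (fun σ => Gen.cls (a := a) (b := b)
        ⟨k', x, CSet.onVertex (yo.map φ) v, CSet.onVertex (yo.map φ) w, hv, hw, σ⟩)
        (SCat.mapSimplex_map (cubeCat.map φ) θ σ)))

/-- The functor `Lev S Δ ⥤ Lev S' Δ` induced by a map of cubical sets. -/
noncomputable def Lev.map {S S' : CSet.{u}} (h : S ⟶ S') (Δ : SimplexCategoryᵒᵖ) :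
    Lev S Δ ⥤ Lev S' Δ :=
  Lev.lift (fun a => Lev.of Δ (CSet.onVertex h a)) (fun g => (g.map h).cls)
    (fun k x v hv => Gen.cls_one k (x ≫ h) v (congrArg (CSet.onVertex h) hv))
    (fun k x v w z hv hw hz σ τ => Gen.cls_mul k (x ≫ h) v w z (congrArg (CSet.onVertex h) hv)
      (congrArg (CSet.onVertex h) hw) (congrArg (CSet.onVertex h) hz) σ τ)
    (fun φ x v w hv hw σ => Gen.cls_nat φ (x ≫ h) v w (congrArg (CSet.onVertex h) hv)
      (congrArg (CSet.onVertex h) hw) σ)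

lemma Lev.act_cls {S : CSet.{u}} {Δ Δ' : SimplexCategoryᵒᵖ} (θ : Δ ⟶ Δ') {a b : CSet.Vertex S}
    (g : Gen S Δ a b) : (Lev.act θ).map g.cls = (g.act θ).cls :=
  Paths.lift_toPath (V := Pt S Δ) _ _

lemma Lev.map_cls {S S' : CSet.{u}} (h : S ⟶ S') {Δ : SimplexCategoryᵒᵖ} {a b : CSet.Vertex S}
    (g : Gen S Δ a b) : (Lev.map h Δ).map g.cls = (g.map h).cls :=
  Paths.lift_toPath (V := Pt S Δ) _ _

/-- The simplicial set of morphisms from `a` to `b` in the rigidification. -/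
noncomputable def rigHom (S : CSet.{u}) (a b : CSet.Vertex S) : SSet.{u} where
  obj Δ := Lev.of Δ a ⟶ Lev.of Δ b
  map θ := ↾fun f => (Lev.act θ).map f
  map_id Δ := by
    ext f
    refine Lev.hom_ext (o := fun a => Lev.of Δ a) (fun f => (Lev.act (𝟙 Δ)).map f) (fun f => f)
      (fun a => (Lev.act (𝟙 Δ)).map_id (Lev.of Δ a)) (fun f g => (Lev.act (𝟙 Δ)).map_comp f g)
      (fun _ => rfl) (fun _ _ => rfl) (fun {a b} g => ?_) f
    refine (Lev.act_cls _ g).trans ?_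
    exact congrArg (fun σ => Gen.cls (a := a) (b := b) ⟨g.k, g.x, g.v, g.w, g.hv, g.hw, σ⟩)
      (Functor.map_id_apply _ _ _)
  map_comp {Δ Δ' Δ''} θ θ' := by
    ext f
    refine Lev.hom_ext (o := fun a => Lev.of Δ'' a) (fun f => (Lev.act (θ ≫ θ')).map f)
      (fun f => (Lev.act θ').map ((Lev.act θ).map f))
      (fun a => (Lev.act _).map_id (Lev.of Δ a)) (fun f g => (Lev.act _).map_comp f g)
      (fun a => (Lev.act θ ⋙ Lev.act θ').map_id (Lev.of Δ a))
      (fun f g => (Lev.act θ ⋙ Lev.act θ').map_comp f g) (fun {a b} g => ?_) f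
    refine (Lev.act_cls _ g).trans (Eq.trans ?_
      ((congrArg (fun f => (Lev.act θ').map f) (Lev.act_cls θ g)).trans (Lev.act_cls θ' _)).symm)
    exact congrArg (fun σ => Gen.cls (a := a) (b := b) ⟨g.k, g.x, g.v, g.w, g.hv, g.hw, σ⟩)
      (Functor.map_comp_apply _ _ _ _)

/-- The rigidification of a cubical set. -/
noncomputable def rigCat (S : CSet.{u}) : SCat.{u} where
  Obj := CSet.Vertex S
  str := enrichedOfSimplices (CSet.Vertex S) (rigHom S)
    (fun a Δ => 𝟙 (Lev.of Δ a))
    (fun {a b c} Δ (f : Lev.of Δ a ⟶ Lev.of Δ b) (g : Lev.of Δ b ⟶ Lev.of Δ c) => f ≫ g)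
    (fun a Δ _ θ => (Lev.act θ).map_id (Lev.of Δ a))
    (fun {a b c Δ _} θ (f : Lev.of Δ a ⟶ Lev.of Δ b) (g : Lev.of Δ b ⟶ Lev.of Δ c) =>
      (Lev.act θ).map_comp f g)
    (fun {a b Δ} (f : Lev.of Δ a ⟶ Lev.of Δ b) => Category.id_comp f)
    (fun {a b Δ} (f : Lev.of Δ a ⟶ Lev.of Δ b) => Category.comp_id f)
    (fun {a b c d Δ} (f : Lev.of Δ a ⟶ Lev.of Δ b) (g : Lev.of Δ b ⟶ Lev.of Δ c)
      (h : Lev.of Δ c ⟶ Lev.of Δ d) => Category.assoc f g h)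

/-- The simplicial functor given by a cube of `S`. -/
noncomputable def rigInc {S : CSet.{u}} (k : Box) (x : yo.{u}.obj k ⟶ S) :
    cubeCat.obj k ⟶ rigCat S :=
  SCat.homMk (C := cubeCat.obj k) (D := rigCat S) (fun v => CSet.onVertex x v)
    (fun {v w} _ σ => Gen.cls ⟨k, x, v, w, rfl, rfl, σ⟩)
    (fun {v w _ _} θ σ => (Lev.act_cls θ ⟨k, x, v, w, rfl, rfl, σ⟩).symm)
    (fun v _ => Gen.cls_one k x v rfl)
    (fun {v w z _} σ τ => (Gen.cls_mul k x v w z rfl rfl rfl σ τ).symm)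

/-- The simplicial functor induced by a map of cubical sets. -/
noncomputable def rigMap {S S' : CSet.{u}} (h : S ⟶ S') : rigCat S ⟶ rigCat S' :=
  SCat.homMk (C := rigCat S) (D := rigCat S') (fun a => CSet.onVertex h a)
    (fun {a b} Δ (f : Lev.of Δ a ⟶ Lev.of Δ b) => (Lev.map h Δ).map f)
    (fun {a b Δ Δ'} θ f => by
      refine Lev.hom_ext (o := fun a => Lev.of Δ' (CSet.onVertex h a))
        (fun f => (Lev.map h Δ').map ((Lev.act θ).map f))
        (fun f => (Lev.act θ).map ((Lev.map h Δ).map f))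
        (fun a => (Lev.act θ ⋙ Lev.map h Δ').map_id (Lev.of Δ a))
        (fun f g => (Lev.act θ ⋙ Lev.map h Δ').map_comp f g)
        (fun a => (Lev.map h Δ ⋙ Lev.act θ).map_id (Lev.of Δ a))
        (fun f g => (Lev.map h Δ ⋙ Lev.act θ).map_comp f g) (fun {a b} g => ?_) f
      refine ((congrArg (fun f => (Lev.map h Δ').map f) (Lev.act_cls θ g)).trans
        (Lev.map_cls h _)).trans ?_
      exact ((congrArg (fun f => (Lev.act θ).map f) (Lev.map_cls h g)).trans
        (Lev.act_cls θ _)).symm)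
    (fun a Δ => (Lev.map h Δ).map_id (Lev.of Δ a))
    (fun {a b c Δ} (f : Lev.of Δ a ⟶ Lev.of Δ b) (g : Lev.of Δ b ⟶ Lev.of Δ c) =>
      (Lev.map h Δ).map_comp f g)

/-! ### The rigidification functor and its universal property -/

namespace SCat

/-- Transport of simplices of morphisms along equalities of objects. -/
def cast {D : SCat.{u}} {x x' y y' : D.Obj} (hx : x = x') (hy : y = y') {Δ : SimplexCategoryᵒᵖ}
    (f : (D.hom x y).obj Δ) : (D.hom x' y').obj Δ :=
  hx ▸ hy ▸ f

lemma cast_one {D : SCat.{u}} {x x' : D.Obj} (hx : x = x') (Δ : SimplexCategoryᵒᵖ) :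
    cast hx hx (D.one x Δ) = D.one x' Δ := by
  subst hx; rfl

lemma cast_mul {D : SCat.{u}} {x x' y y' z z' : D.Obj} (hx : x = x') (hy : y = y') (hz : z = z')
    {Δ : SimplexCategoryᵒᵖ} (f : (D.hom x y).obj Δ) (g : (D.hom y z).obj Δ) :
    cast hx hz (D.mul f g) = D.mul (cast hx hy f) (cast hy hz g) := by
  subst hx hy hz; rfl

lemma cast_map {D : SCat.{u}} {x x' y y' : D.Obj} (hx : x = x') (hy : y = y')
    {Δ Δ' : SimplexCategoryᵒᵖ} (θ : Δ ⟶ Δ') (f : (D.hom x y).obj Δ) :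
    cast hx hy ((D.hom x y).map θ f) = (D.hom x' y').map θ (cast hx hy f) := by
  subst hx hy; rfl

lemma cast_cast {D : SCat.{u}} {x x' x'' y y' y'' : D.Obj} (hx : x = x') (hy : y = y')
    (hx' : x' = x'') (hy' : y' = y'') {Δ : SimplexCategoryᵒᵖ} (f : (D.hom x y).obj Δ) :
    cast hx' hy' (cast hx hy f) = cast (hx.trans hx') (hy.trans hy') f := by
  subst hx hy hx' hy'; rfl

lemma cast_mapSimplex_of_eq {C D : SCat.{u}} {F G : C ⟶ D} (h : F = G) {x y : C.Obj} {z w : D.Obj}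
    (hx : F.obj x = z) (hy : F.obj y = w) (hx' : G.obj x = z) (hy' : G.obj y = w)
    {Δ : SimplexCategoryᵒᵖ} (f : (C.hom x y).obj Δ) :
    cast hx hy (mapSimplex F f) = cast hx' hy' (mapSimplex G f) := by
  subst h; rfl

lemma hom_ext {C D : SCat.{u}} {F G : C ⟶ D} (ho : ∀ x, F.obj x = G.obj x)
    (hm : ∀ {x y : C.Obj} {Δ : SimplexCategoryᵒᵖ} (f : (C.hom x y).obj Δ),
      cast (ho x) (ho y) (mapSimplex F f) = mapSimplex G f) : F = G := by
  match F, G with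
  | .mk F_obj F_map _ _, .mk G_obj G_map _ _ =>
    obtain rfl : F_obj = G_obj := funext fun X => ho X
    congr
    ext X Y Δ f
    exact hm f

end SCat

/-- The rigidification functor `𝔆^□`. -/
noncomputable def rig : CSet.{u} ⥤ SCat.{u} where
  obj := rigCat
  map h := rigMap h
  map_id S := by
    refine SCat.hom_ext (fun _ => rfl) (fun {a b Δ} f => ?_)
    refine Lev.hom_ext (o := fun a => Lev.of Δ a) (fun f => (Lev.map (𝟙 S) Δ).map f) (fun f => f)
      (fun a => (Lev.map (𝟙 S) Δ).map_id (Lev.of Δ a)) (fun f g => (Lev.map (𝟙 S) Δ).map_comp f g)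
      (fun _ => rfl) (fun _ _ => rfl) (fun {a b} g => ?_) f
    exact Lev.map_cls _ g
  map_comp {S S' S''} h h' := by
    refine SCat.hom_ext (fun _ => rfl) (fun {a b Δ} f => ?_)
    refine Lev.hom_ext (o := fun a => Lev.of Δ (CSet.onVertex h' (CSet.onVertex h a)))
      (fun f => (Lev.map (h ≫ h') Δ).map f)
      (fun f => (Lev.map h' Δ).map ((Lev.map h Δ).map f))
      (fun a => (Lev.map (h ≫ h') Δ).map_id (Lev.of Δ a))
      (fun f g => (Lev.map (h ≫ h') Δ).map_comp f g)
      (fun a => (Lev.map h Δ ⋙ Lev.map h' Δ).map_id (Lev.of Δ a))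
      (fun f g => (Lev.map h Δ ⋙ Lev.map h' Δ).map_comp f g) (fun {a b} g => ?_) f
    refine (Lev.map_cls _ g).trans (Eq.trans ?_
      ((congrArg (fun f => (Lev.map h' Δ).map f) (Lev.map_cls h g)).trans
        (Lev.map_cls h' _)).symm)
    rfl

lemma rigInc_comp_rigMap {S S' : CSet.{u}} (k : Box) (x : yo.{u}.obj k ⟶ S) (h : S ⟶ S') :
    rigInc k x ≫ rigMap h = rigInc k (x ≫ h) :=
  SCat.hom_ext (fun _ => rfl) (fun {v w _} σ => Lev.map_cls h ⟨k, x, v, w, rfl, rfl, σ⟩)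

lemma cubeCat_map_comp_rigInc {S : CSet.{u}} {k k' : Box} (φ : k ⟶ k') (x : yo.{u}.obj k' ⟶ S) :
    cubeCat.map φ ≫ rigInc k' x = rigInc k (yo.map φ ≫ x) :=
  SCat.hom_ext (fun _ => rfl) (fun {v w _} σ => (Gen.cls_nat φ x v w rfl rfl σ).symm)

/-- The unit: `𝔆^□` extends the given functor on cubes. -/
noncomputable def rigUnit : cubeCat.{u} ⟶ yo ⋙ rig where
  app k := rigInc k (𝟙 _)
  naturality k k' φ :=
    (cubeCat_map_comp_rigInc φ (𝟙 _)).trans (Eq.trans (by rw [Category.comp_id, Category.id_comp])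
      (rigInc_comp_rigMap k (𝟙 _) (yo.map φ)).symm)

/-- The objects of `D`, as the objects of the category of `Δ`-simplices of morphisms. -/
structure SCat.LevObj (D : SCat.{u}) (Δ : SimplexCategoryᵒᵖ) : Type u where
  /-- the object -/
  as : D.Obj

/-- The category of `Δ`-simplices of morphisms of a simplicial category. -/
instance (D : SCat.{u}) (Δ : SimplexCategoryᵒᵖ) : Category (SCat.LevObj D Δ) where
  Hom x y := (D.hom x.as y.as).obj Δ
  id x := D.one x.as Δ
  comp f g := D.mul f g
  id_comp f := D.one_mul f
  comp_id f := D.mul_one f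
  assoc f g h := D.mul_assoc f g h

/-- The action on vertices of the functor induced by a compatible family. -/
def rigDescObj {S : CSet.{u}} {D : SCat.{u}}
    (F : ∀ (k : Box) (_ : yo.{u}.obj k ⟶ S), cubeCat.obj k ⟶ D) (a : CSet.Vertex S) : D.Obj := (F ⟨0⟩ (CSet.pt a)).obj star

lemma rigDescObj_eq {S : CSet.{u}} {D : SCat.{u}}
    (F : ∀ (k : Box) (_ : yo.{u}.obj k ⟶ S), cubeCat.obj k ⟶ D)
    (hF : ∀ {k k' : Box} (φ : k ⟶ k') (x : yo.{u}.obj k' ⟶ S),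
      F k (yo.map φ ≫ x) = cubeCat.map φ ≫ F k' x)
    {k : Box} (x : yo.{u}.obj k ⟶ S) (v : CSet.Vertex (yo.{u}.obj k))
    {a : CSet.Vertex S} (hv : CSet.onVertex x v = a) : (F k x).obj v = rigDescObj F a := by
  subst hv
  have e : yo.map v.down ≫ x = CSet.pt (CSet.onVertex x v) := by
    apply CSet.cube_zero_hom_ext
    rw [CSet.onVertex_pt]
    rfl
  have h := hF v.down x
  rw [e] at h
  have h' : (F ⟨0⟩ (CSet.pt (CSet.onVertex x v))).obj star = (cubeCat.map v.down ≫ F k x).obj star :=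
    congrArg (fun G : cubeCat.obj ⟨0⟩ ⟶ D => G.obj star) h
  exact h'.symm

section Desc

variable {S : CSet.{u}} {D : SCat.{u}} (F : ∀ (k : Box) (_ : yo.{u}.obj k ⟶ S), cubeCat.obj k ⟶ D)
  (hF : ∀ {k k' : Box} (φ : k ⟶ k') (x : yo.{u}.obj k' ⟶ S),
    F k (yo.map φ ≫ x) = cubeCat.map φ ≫ F k' x)

/-- The action on simplices. -/
noncomputable def rigDescLev (Δ : SimplexCategoryᵒᵖ) : Lev S Δ ⥤ SCat.LevObj D Δ :=
  Lev.lift (fun a => ⟨rigDescObj F a⟩)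
    (fun g => SCat.cast (rigDescObj_eq F hF g.x g.v g.hv) (rigDescObj_eq F hF g.x g.w g.hw)
      (SCat.mapSimplex (F g.k g.x) g.σ))
    (fun k x v _ => (congrArg (SCat.cast _ _) (SCat.mapSimplex_one (F k x) v Δ)).trans
      (SCat.cast_one _ _))
    (fun k x _ _ _ _ _ _ σ τ => ((congrArg (SCat.cast _ _)
      (SCat.mapSimplex_mul (F k x) σ τ)).trans (SCat.cast_mul _ _ _ _ _)).symm)
    (fun φ x _ _ _ _ σ => SCat.cast_mapSimplex_of_eq (hF φ x) _ _ _ _ σ)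

lemma rigDescLev_cls {Δ : SimplexCategoryᵒᵖ} {a b : CSet.Vertex S} (g : Gen S Δ a b) :
    (rigDescLev F hF Δ).map g.cls =
      SCat.cast (rigDescObj_eq F hF g.x g.v g.hv) (rigDescObj_eq F hF g.x g.w g.hw)
      (SCat.mapSimplex (F g.k g.x) g.σ) :=
  Paths.lift_toPath (V := Pt S Δ) _ _

/-- The simplicial functor induced by a compatible family. -/
noncomputable def rigDesc : rigCat S ⟶ D :=
  SCat.homMk (C := rigCat S) (D := D) (rigDescObj F)
    (fun {a b} Δ (f : Lev.of Δ a ⟶ Lev.of Δ b) => (rigDescLev F hF Δ).map f)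
    (fun {a b Δ Δ'} θ f => by
      refine Lev.hom_ext (D := SCat.LevObj D Δ') (o := fun a => ⟨rigDescObj F a⟩)
        (fun f => (rigDescLev F hF Δ').map ((Lev.act θ).map f))
        (fun f => (D.hom _ _).map θ ((rigDescLev F hF Δ).map f))
        (fun a => (Lev.act θ ⋙ rigDescLev F hF Δ').map_id (Lev.of Δ a))
        (fun f g => (Lev.act θ ⋙ rigDescLev F hF Δ').map_comp f g)
        (fun a => (congrArg ((D.hom _ _).map θ) ((rigDescLev F hF Δ).map_id (Lev.of Δ a))).trans
          (D.map_one _ θ))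
        (fun f g => (congrArg ((D.hom _ _).map θ) ((rigDescLev F hF Δ).map_comp f g)).trans
          (D.map_mul θ _ _)) (fun {a b} g => ?_) f
      refine ((congrArg (fun f => (rigDescLev F hF Δ').map f) (Lev.act_cls θ g)).trans
        (rigDescLev_cls F hF _)).trans ?_
      refine Eq.trans ?_ (congrArg ((D.hom _ _).map θ) (rigDescLev_cls F hF g)).symm
      exact (congrArg (SCat.cast _ _) (SCat.mapSimplex_map (F g.k g.x) θ g.σ)).trans
        (SCat.cast_map _ _ θ _))
    (fun a Δ => (rigDescLev F hF Δ).map_id (Lev.of Δ a))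
    (fun {a b c Δ} (f : Lev.of Δ a ⟶ Lev.of Δ b) (g : Lev.of Δ b ⟶ Lev.of Δ c) =>
      (rigDescLev F hF Δ).map_comp f g)

lemma rigInc_rigDesc (k : Box) (x : yo.{u}.obj k ⟶ S) : rigInc k x ≫ rigDesc F hF = F k x := by
  refine (SCat.hom_ext (fun v => rigDescObj_eq F hF x v rfl) (fun {v w Δ} σ => ?_)).symm
  exact (rigDescLev_cls F hF ⟨k, x, v, w, rfl, rfl, σ⟩).symm

end Desc

lemma rig_hom_ext {S : CSet.{u}} {D : SCat.{u}} {G G' : rigCat S ⟶ D}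
    (h : ∀ (k : Box) (x : yo.{u}.obj k ⟶ S), rigInc k x ≫ G = rigInc k x ≫ G') : G = G' := by
  have ho : ∀ a : CSet.Vertex S, G.obj a = G'.obj a := fun a => by
    have h1 : G.obj (CSet.onVertex (CSet.pt a) star) = G'.obj (CSet.onVertex (CSet.pt a) star) :=
      congrArg (fun H : cubeCat.obj ⟨0⟩ ⟶ D => H.obj star) (h ⟨0⟩ (CSet.pt a))
    rwa [CSet.onVertex_pt] at h1
  refine SCat.hom_ext ho (fun {a b Δ} f => ?_)
  refine Lev.hom_ext (D := SCat.LevObj D Δ) (o := fun a => ⟨G'.obj a⟩)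
    (fun {a b} f => SCat.cast (ho a) (ho b) (SCat.mapSimplex G f)) (fun f => SCat.mapSimplex G' f)
    (fun a => (congrArg (SCat.cast _ _) (SCat.mapSimplex_one G a Δ)).trans (SCat.cast_one _ _))
    (fun f g => (congrArg (SCat.cast _ _) (SCat.mapSimplex_mul G f g)).trans
      (SCat.cast_mul _ _ _ _ _))
    (fun a => SCat.mapSimplex_one G' a Δ)
    (fun f g => SCat.mapSimplex_mul G' f g) (fun {a b} g => ?_) f
  obtain ⟨k, x, v, w, rfl, rfl, σ⟩ := g
  exact SCat.cast_mapSimplex_of_eq (h k x) _ _ rfl rfl σ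

/-- `𝔆^□`, with its unit, is the left Kan extension of `[1]ⁿ ↦ pathCat (□ⁿ)` along the Yoneda
embedding. -/
noncomputable def rigIsKan :
    (Functor.LeftExtension.mk rig.{u} rigUnit).IsPointwiseLeftKanExtension := fun S =>
  have hi : ∀ g : CostructuredArrow yo.{u} S,
      rigInc g.left g.hom = ((Functor.LeftExtension.mk rig.{u} rigUnit).coconeAt S).ι.app g :=
    fun g => (congrArg (rigInc g.left) (Category.id_comp g.hom)).symm.trans
      (rigInc_comp_rigMap g.left (𝟙 _) g.hom).symm
  have hF : ∀ (s : Cocone (CostructuredArrow.proj yo.{u} S ⋙ cubeCat)) {k k' : Box} (φ : k ⟶ k')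
      (x : yo.{u}.obj k' ⟶ S), s.ι.app (CostructuredArrow.mk (yo.map φ ≫ x)) =
        cubeCat.map φ ≫ s.ι.app (CostructuredArrow.mk x) := fun s _ _ φ x =>
    (s.w (CostructuredArrow.homMk φ rfl :
      CostructuredArrow.mk (yo.map φ ≫ x) ⟶ CostructuredArrow.mk x)).symm
  { desc := fun s => rigDesc (fun _ x => s.ι.app (CostructuredArrow.mk x)) (hF s)
    fac := fun s g => (congrArg (· ≫ _) (hi g).symm).trans (rigInc_rigDesc _ (hF s) g.left g.hom)
    uniq := fun s m hm => rig_hom_ext (fun k x =>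
      ((congrArg (· ≫ m) (hi (CostructuredArrow.mk x))).trans (hm (CostructuredArrow.mk x))).trans
        (rigInc_rigDesc (fun _ x => s.ι.app (CostructuredArrow.mk x)) (hF s) k x).symm) }

/-! ### Mapping spaces and necklaces -/

lemma rig_hom_eq {X Y : BiCSet.{u}} (f : X ⟶ Y) :
    (rig.obj Y.S).hom ((rig.map f.hom).obj X.a) ((rig.map f.hom).obj X.b) =
      (rig.obj Y.S).hom Y.a Y.b := by
  have ha : (rig.map f.hom).obj X.a = Y.a := f.map_a
  have hb : (rig.map f.hom).obj X.b = Y.b := f.map_b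
  rw [ha, hb]

/-- The map `𝔆^□(S)(a,b) → 𝔆^□(S')(a',b')` induced by a map `S_{a,b} → S'_{a',b'}`. -/
noncomputable def CtMap {X Y : BiCSet.{u}} (f : X ⟶ Y) :
    (rig.obj X.S).hom X.a X.b ⟶ (rig.obj Y.S).hom Y.a Y.b :=
  (rig.map f.hom).map X.a X.b ≫ eqToHom (rig_hom_eq f)

lemma CtMap_id (X : BiCSet.{u}) : CtMap (𝟙 X) = 𝟙 _ := by
  have key : ∀ (F : rig.obj X.S ⟶ rig.obj X.S) (hF : F = 𝟙 _)
      (h : (rig.obj X.S).hom (F.obj X.a) (F.obj X.b) = (rig.obj X.S).hom X.a X.b),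
      F.map X.a X.b ≫ eqToHom h = 𝟙 _ := by
    rintro _ rfl h
    rfl
  exact key _ (rig.map_id X.S) _

lemma CtMap_comp {X Y Z : BiCSet.{u}} (f : X ⟶ Y) (g : Y ⟶ Z) :
    CtMap (f ≫ g) = CtMap f ≫ CtMap g := by
  obtain ⟨S', a', b'⟩ := Y
  obtain ⟨S'', a'', b''⟩ := Z
  obtain ⟨f, ha, hb⟩ := f
  obtain ⟨g, ha', hb'⟩ := g
  dsimp only at ha hb ha' hb' f g
  subst ha hb ha' hb'
  have key : ∀ (F : rig.obj X.S ⟶ rig.obj S'') (hF : F = rig.map f ≫ rig.map g)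
      (h : (rig.obj S'').hom (F.obj X.a) (F.obj X.b) =
        (rig.obj S'').hom (CSet.onVertex g (CSet.onVertex f X.a))
          (CSet.onVertex g (CSet.onVertex f X.b))),
      F.map X.a X.b ≫ eqToHom h = (rig.map f).map X.a X.b ≫
        (rig.map g).map (CSet.onVertex f X.a) (CSet.onVertex f X.b) := by
    rintro _ rfl h
    rfl
  exact key _ (rig.map_comp f g) _

/-- The functor `𝔆^□_t`, sending `S_{a,b}` to the mapping space `𝔆^□(S)(a,b)`. -/
noncomputable def Ct : BiCSet.{u} ⥤ SSet.{u} where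
  obj X := (rig.obj X.S).hom X.a X.b
  map f := CtMap f
  map_id := CtMap_id
  map_comp := CtMap_comp

/-- The diagram `(T → S_{a,b}) ↦ 𝔆^□_t(T)`, indexed by the category of necklaces over `S_{a,b}`. -/
noncomputable abbrev neckDiagram (X : BiCSet.{u}) : CostructuredArrow necIncl.{u} X ⥤ SSet.{u} :=
  CostructuredArrow.proj necIncl X ⋙ necIncl ⋙ Ct

/-- The functor `E_t`, sending `S_{a,b}` to the colimit of `𝔆^□_t(T)` over the category of
necklaces over `S_{a,b}`; a map `f : S_{a,b} → S'_{a',b'}` acts by sending the summand of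
`T → S_{a,b}` to the summand of its composite with `f`. -/
noncomputable def Et : BiCSet.{u} ⥤ SSet.{u} :=
  necIncl.{u}.pointwiseLeftKanExtension (necIncl ⋙ Ct)

lemma Et_obj (X : BiCSet.{u}) : Et.obj X = colimit (neckDiagram X) := rfl

end CubRig

open CubRig

namespace CubRig

open BiCSet

/-! ### Intervals in cubes -/

/-! The comparison map is tested one simplicial degree `Δ` at a time. There the right side is a hom
set of `Lev S Δ`, a category given by generators (a cube of `S` with a simplex of paths between two
of its vertices) and relations. On the left side, a simplex is represented by a necklace `T → S`
together with a simplex `t` of the mapping space of `T`, and `NeckLev` is the set of such pairs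
modulo maps of necklaces over `S`. Concatenation of necklaces makes the sets `NeckLev` the hom sets
of a category on the vertices of `S`, so a map from right to left can be defined as a functor, by
its values on generators.

A generator need not join the least to the greatest vertex of its cube, so the cube itself is not
yet a bead. The remedy is geometric: if there is a path from `v` to `w` then `v ≤ w`, and the
interval `[v, w]` is a face and a retract of the cube (`exists_interval_retract`). A necklace that
maps to the cube with end points `v` and `w` stays inside this interval (`neck_hom_cube`). Hence the
simplex can be retracted to the interval without loss (`Gen.pushHom_incl_retr`), and every necklace
in the cube that carries the simplex defines the same class over `S` (`Gen.mk_eq_toNeckLev`). This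
independence gives the three defining relations of `Lev S Δ`.

One composite is the identity because it is so on generators (`Lev.toLev_toNeckLev`). For the other,
naturality reduces the claim to a necklace `T` over itself. The identity of `T` is terminal among
necklaces over `T`, so a class over `T` is determined by its image in the mapping space
(`NeckLev.eq_mk_id_toLev`), and the first composite applies. -/

lemma IsBoxMap.monotone {m n : ℕ} {f : (Fin m → Bool) → (Fin n → Bool)} (hf : IsBoxMap f) :
    Monotone f := by
  induction hf with
  | id n => exact monotone_id
  | comp _ _ hf hg => exact hg.comp hf
  | face i ε =>
    intro x y h j
    induction j using Fin.succAboveCases i with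
    | x => simp [CubRig.face]
    | p j => simpa [CubRig.face] using h j
  | degen i => exact fun x y h j => h _
  | conn i =>
    intro x y h j
    dsimp only [CubRig.conn]
    split_ifs
    · exact h _
    · exact max_le_max (h _) (h _)
    · exact h _

/-- The product of `[1]` with a map of cubes. -/
def consMap {m n : ℕ} (f : (Fin m → Bool) → (Fin n → Bool)) (x : Fin (m + 1) → Bool) :
    Fin (n + 1) → Bool :=
  Fin.cons (α := fun _ => Bool) (x 0) (f (Fin.tail x))

/-- The product of `[1]` with a generator is the generator of the same kind with its index raised by
one. This allows intervals to be built one coordinate at a time. -/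
lemma IsBoxMap.consMap {m n : ℕ} {f : (Fin m → Bool) → (Fin n → Bool)} (hf : IsBoxMap f) :
    IsBoxMap (consMap f) := by
  induction hf with
  | id n =>
    convert IsBoxMap.id (n + 1) using 1
    funext x
    exact Fin.cons_self_tail x
  | comp _ _ hf hg => exact hf.comp hg
  | face i ε =>
    convert IsBoxMap.face i.succ ε using 1
    funext x
    obtain ⟨b, y, rfl⟩ : ∃ b y, x = Fin.cons (α := fun _ => Bool) b y :=
      ⟨_, _, (Fin.cons_self_tail x).symm⟩
    simp only [CubRig.consMap, CubRig.face, Fin.cons_zero, Fin.tail_cons]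
    refine Fin.eq_insertNth_iff.2 ⟨by simp, ?_⟩
    funext j
    refine Fin.cases ?_ (fun j => ?_) j <;> simp [Fin.removeNth]
  | degen i =>
    convert IsBoxMap.degen i.succ using 1
    funext x j
    refine Fin.cases ?_ (fun j => ?_) j
    · simp [CubRig.consMap, CubRig.degen]
    · simp [CubRig.consMap, CubRig.degen, Fin.tail]
  | conn i =>
    convert IsBoxMap.conn i.succ using 1
    funext x j
    refine Fin.cases ?_ (fun j => ?_) j
    · simp [CubRig.consMap, CubRig.conn]
    · simp [CubRig.consMap, CubRig.conn, Fin.tail]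

/-- The interval `[v, w]` of `[1]ᵏ` is a face, and a retract of `[1]ᵏ`. -/
lemma exists_interval_retract : ∀ {k : ℕ} (v w : Fin k → Bool), v ≤ w →
    ∃ (d : ℕ) (ι : (⟨d⟩ : Box) ⟶ ⟨k⟩) (π : (⟨k⟩ : Box) ⟶ ⟨d⟩),
      ι.toFun (fun _ => false) = v ∧ ι.toFun (fun _ => true) = w ∧
      (∀ x, π.toFun (ι.toFun x) = x) ∧ ∀ x, v ≤ x → x ≤ w → ι.toFun (π.toFun x) = x
  | 0, v, w, _ => ⟨0, 𝟙 _, 𝟙 _, Subsingleton.elim _ _, Subsingleton.elim _ _,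
      fun _ => rfl, fun _ _ _ => rfl⟩
  | k + 1, v, w, h => by
    obtain ⟨d, ι, π, h0, h1, hr, hi⟩ := exists_interval_retract (Fin.tail v) (Fin.tail w)
      (fun j => h j.succ)
    have htail : ∀ x, v ≤ x → x ≤ w → ι.toFun (π.toFun (Fin.tail x)) = Fin.tail x :=
      fun x hv hw => hi _ (fun j => hv j.succ) (fun j => hw j.succ)
    -- If `v` and `w` agree at the first coordinate, it is constant on the interval: the inclusion
    -- inserts its value by a face and the retraction forgets it. Otherwise the coordinate is free
    -- on the interval, and both maps are multiplied by `[1]`.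
    by_cases hvw : v 0 = w 0
    · refine ⟨d, ι ≫ Box.face 0 (v 0), (⟨degen 0, .degen 0⟩ : Box.Hom ⟨k + 1⟩ ⟨k⟩) ≫ π,
        ?_, ?_, fun x => ?_, fun x hv hw => ?_⟩
      · change CubRig.face 0 (v 0) (ι.toFun _) = v
        simp [CubRig.face, h0]
      · change CubRig.face 0 (v 0) (ι.toFun _) = w
        simp [CubRig.face, h1, hvw]
      · change π.toFun (degen 0 (CubRig.face 0 (v 0) (ι.toFun x))) = x
        refine Eq.trans (congrArg π.toFun ?_) (hr x)
        funext j
        simp [CubRig.face, degen]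
      · change CubRig.face 0 (v 0) (ι.toFun (π.toFun (degen 0 x))) = x
        have hd : degen 0 x = Fin.tail x := by
          funext j
          simp [degen, Fin.tail]
        have hx : v 0 = x 0 := le_antisymm (hv 0) (hvw ▸ hw 0)
        rw [hd, htail x hv hw, hx]
        simp [CubRig.face]
    · have hv0 : v 0 = false ∧ w 0 = true := by
        have := h 0
        revert this hvw
        cases v 0 <;> cases w 0 <;> simp
      refine ⟨d + 1, ⟨consMap ι.toFun, ι.isBoxMap.consMap⟩, ⟨consMap π.toFun, π.isBoxMap.consMap⟩,
        ?_, ?_, fun x => ?_, fun x hv hw => ?_⟩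
      · refine Eq.trans ?_ (Fin.cons_self_tail v)
        rw [← h0, hv0.1]
        rfl
      · refine Eq.trans ?_ (Fin.cons_self_tail w)
        rw [← h1, hv0.2]
        rfl
      · refine Eq.trans ?_ (Fin.cons_self_tail x)
        exact congrArg (Fin.cons (α := fun _ => Bool) (x 0)) (hr (Fin.tail x))
      · refine Eq.trans ?_ (Fin.cons_self_tail x)
        exact congrArg (Fin.cons (α := fun _ => Bool) (x 0)) (htail x hv hw)

/-- The element of `[1]ⁿ` that underlies a vertex of `□ⁿ`. -/
def vertexVal {k : Box} (v : CSet.Vertex (yo.{u}.obj k)) : Fin k.dim → Bool :=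
  v.down.toFun Fin.elim0

lemma vertexVal_injective {k : Box} {v w : CSet.Vertex (yo.{u}.obj k)}
    (h : vertexVal v = vertexVal w) : v = w := by
  obtain ⟨v⟩ := v
  obtain ⟨w⟩ := w
  congr 1
  apply Box.Hom.ext
  funext x
  rw [Subsingleton.elim x Fin.elim0]
  exact h

/-- A retraction of `[1]ᵏ` onto the interval between two vertices. -/
structure IntervalRetract {k : Box} (v w : CSet.Vertex (yo.{u}.obj k)) where
  /-- the dimension of the interval -/
  d : ℕ
  /-- the inclusion -/
  ι : (⟨d⟩ : Box) ⟶ k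
  /-- the retraction -/
  π : k ⟶ ⟨d⟩
  ι_least : CSet.onVertex (yo.map ι) (cubeVertex fun _ => false) = v
  ι_greatest : CSet.onVertex (yo.map ι) (cubeVertex fun _ => true) = w
  π_least : CSet.onVertex (yo.map π) v = cubeVertex fun _ => false
  π_greatest : CSet.onVertex (yo.map π) w = cubeVertex fun _ => true
  fixed : ∀ x, vertexVal v ≤ x → x ≤ vertexVal w → ι.toFun (π.toFun x) = x

lemma nonempty_intervalRetract {k : Box} (v w : CSet.Vertex (yo.{u}.obj k))
    (h : vertexVal v ≤ vertexVal w) : Nonempty (IntervalRetract v w) := by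
  obtain ⟨d, ι, π, h0, h1, hr, hi⟩ := exists_interval_retract _ _ h
  refine ⟨⟨d, ι, π, vertexVal_injective h0, vertexVal_injective h1, vertexVal_injective ?_,
    vertexVal_injective ?_, hi⟩⟩
  · exact (congrArg π.toFun h0.symm).trans (hr _)
  · exact (congrArg π.toFun h1.symm).trans (hr _)

/-- A map from a necklace to a cube sends the base vertices to comparable vertices, and it is fixed
by the endomorphisms of the cube that fix the interval between them. -/
lemma neck_hom_cube {k : Box} : ∀ (l : List ℕ+) (h : (neck.{u} l).S ⟶ yo.{u}.obj k),
    vertexVal (CSet.onVertex h (neck l).a) ≤ vertexVal (CSet.onVertex h (neck l).b) ∧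
    ∀ (e : k ⟶ k), (∀ x, vertexVal (CSet.onVertex h (neck l).a) ≤ x →
      x ≤ vertexVal (CSet.onVertex h (neck l).b) → e.toFun x = x) → h ≫ yo.map e = h
  | [], h => by
    -- The empty necklace is a point: its two base vertices coincide, and a map out of it is
    -- determined by one vertex.
    refine ⟨le_refl _, fun e he => CSet.cube_zero_hom_ext (vertexVal_injective ?_)⟩
    exact he _ le_rfl le_rfl
  | n :: l, h => by
    obtain ⟨h1, h2⟩ := neck_hom_cube l (inr (BiCSet.cube n) (neck l) ≫ h)
    have hg : CSet.onVertex (inl (BiCSet.cube n) (neck l) ≫ h) (BiCSet.cube n).b =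
        CSet.onVertex (inr (BiCSet.cube n) (neck l) ≫ h) (neck l).a :=
      congrArg (CSet.onVertex h) (glue _ _)
    -- By full faithfulness of the Yoneda embedding the first bead is a map of `□`. It is monotone,
    -- so its image lies between the images of the extreme vertices, and the greatest of these is
    -- where the rest of the necklace starts.
    obtain ⟨φ, hφ⟩ : ∃ φ : (⟨n⟩ : Box) ⟶ k, inl (BiCSet.cube n) (neck l) ≫ h = yo.map φ :=
      ⟨(yo.{u}.preimage (inl (BiCSet.cube n) (neck l) ≫ h)), (yo.{u}.map_preimage _).symm⟩
    have ha : vertexVal (CSet.onVertex h (neck (n :: l)).a) = φ.toFun fun _ => false := by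
      change vertexVal (CSet.onVertex (inl (BiCSet.cube n) (neck l) ≫ h) (BiCSet.cube n).a) = _
      rw [hφ]; rfl
    have hm : vertexVal (CSet.onVertex (inr (BiCSet.cube n) (neck l) ≫ h) (neck l).a) =
        φ.toFun fun _ => true := by
      rw [← hg, hφ]; rfl
    have hle : vertexVal (CSet.onVertex h (neck (n :: l)).a) ≤
        vertexVal (CSet.onVertex (inr (BiCSet.cube n) (neck l) ≫ h) (neck l).a) := by
      rw [ha, hm]
      exact φ.isBoxMap.monotone (fun _ => Bool.false_le _)
    refine ⟨hle.trans h1, fun e he => wedge_hom_ext ?_ ?_⟩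
    · refine (Category.assoc _ _ _).symm.trans ((congrArg (· ≫ yo.map e) hφ).trans
        (Eq.trans ?_ hφ.symm))
      refine (yo.map_comp φ e).symm.trans (congrArg yo.map ?_)
      apply Box.Hom.ext
      funext x
      refine he _ ?_ ?_
      · rw [ha]
        exact φ.isBoxMap.monotone (fun _ => Bool.false_le _)
      · refine le_trans ?_ h1
        rw [hm]
        exact φ.isBoxMap.monotone (fun _ => Bool.le_true _)
    · exact (Category.assoc _ _ _).symm.trans (h2 e (fun x hx hx' => he x (hle.trans hx) hx'))

/-! ### Transport of simplices of morphisms along pointed maps -/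

/-- The map induced on simplices of morphisms by a map of cubical sets, with prescribed values of
the end points. -/
noncomputable def Lev.push {S S' : CSet.{u}} (h : S ⟶ S') {Δ : SimplexCategoryᵒᵖ}
    {a b : CSet.Vertex S} {a' b' : CSet.Vertex S'} (ha : CSet.onVertex h a = a')
    (hb : CSet.onVertex h b = b') (t : Lev.of Δ a ⟶ Lev.of Δ b) : Lev.of Δ a' ⟶ Lev.of Δ b' :=
  ha ▸ hb ▸ (Lev.map h Δ).map t

/-- Once the base vertices of `Y` are substituted, both transports are trivial. This links the
mapping space functor to `Lev.push`, whose end points are prescribed freely. -/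
lemma CtMap_app_apply {X Y : BiCSet.{u}} (f : X ⟶ Y) {Δ : SimplexCategoryᵒᵖ}
    (t : Lev.of Δ X.a ⟶ Lev.of Δ X.b) :
    (CtMap f).app Δ t = Lev.push f.hom f.map_a f.map_b t := by
  obtain ⟨S', a', b'⟩ := Y
  obtain ⟨f, ha, hb⟩ := f
  dsimp only at ha hb f
  subst ha hb
  rfl

/-- This is functoriality of the mapping space, read off from `CtMap_comp` by taking the prescribed
end points as base vertices. -/
lemma Lev.push_push {S S' S'' : CSet.{u}} (h : S ⟶ S') (h' : S' ⟶ S'') {Δ : SimplexCategoryᵒᵖ}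
    {a b : CSet.Vertex S} {a' b' : CSet.Vertex S'} {a'' b'' : CSet.Vertex S''}
    (ha : CSet.onVertex h a = a') (hb : CSet.onVertex h b = b')
    (ha' : CSet.onVertex h' a' = a'') (hb' : CSet.onVertex h' b' = b'')
    (t : Lev.of Δ a ⟶ Lev.of Δ b) :
    Lev.push h' ha' hb' (Lev.push h ha hb t) =
      Lev.push (h ≫ h') ((congrArg (CSet.onVertex h') ha).trans ha')
        ((congrArg (CSet.onVertex h') hb).trans hb') t := by
  let f : (⟨S, a, b⟩ : BiCSet.{u}) ⟶ ⟨S', a', b'⟩ := ⟨h, ha, hb⟩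
  let g : (⟨S', a', b'⟩ : BiCSet.{u}) ⟶ ⟨S'', a'', b''⟩ := ⟨h', ha', hb'⟩
  have e : (CtMap (f ≫ g)).app Δ t = (CtMap g).app Δ ((CtMap f).app Δ t) := by
    rw [CtMap_comp]
    rfl
  exact ((CtMap_app_apply (f ≫ g) t).symm.trans (e.trans ((congrArg ((CtMap g).app Δ)
    (CtMap_app_apply f t)).trans (CtMap_app_apply g _)))).symm

lemma Lev.push_id {S : CSet.{u}} {Δ : SimplexCategoryᵒᵖ} {a b : CSet.Vertex S}
    (ha : CSet.onVertex (𝟙 S) a = a) (hb : CSet.onVertex (𝟙 S) b = b)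
    (t : Lev.of Δ a ⟶ Lev.of Δ b) : Lev.push (𝟙 S) ha hb t = t :=
  (CtMap_app_apply (𝟙 (⟨S, a, b⟩ : BiCSet.{u})) t).symm.trans
    (congrArg (fun m => m.app Δ t) (CtMap_id ⟨S, a, b⟩))

lemma Lev.push_one {S S' : CSet.{u}} (h : S ⟶ S') {Δ : SimplexCategoryᵒᵖ}
    {a : CSet.Vertex S} {a' : CSet.Vertex S'} (ha ha₂ : CSet.onVertex h a = a') :
    Lev.push h ha ha₂ (𝟙 (Lev.of Δ a)) = 𝟙 (Lev.of Δ a') := by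
  subst ha
  exact (Lev.map h Δ).map_id _

lemma Lev.push_mul {S S' : CSet.{u}} (h : S ⟶ S') {Δ : SimplexCategoryᵒᵖ}
    {a b c : CSet.Vertex S} {a' b' c' : CSet.Vertex S'} (ha : CSet.onVertex h a = a')
    (hb : CSet.onVertex h b = b') (hc : CSet.onVertex h c = c') (t : Lev.of Δ a ⟶ Lev.of Δ b)
    (t' : Lev.of Δ b ⟶ Lev.of Δ c) :
    Lev.push h ha hc (t ≫ t') = Lev.push h ha hb t ≫ Lev.push h hb hc t' := by
  subst ha hb hc
  exact (Lev.map h Δ).map_comp t t'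

lemma Lev.push_cls {S S' : CSet.{u}} (h : S ⟶ S') {Δ : SimplexCategoryᵒᵖ}
    {a b : CSet.Vertex S} {a' b' : CSet.Vertex S'} (ha : CSet.onVertex h a = a')
    (hb : CSet.onVertex h b = b') (g : Gen S Δ a b) :
    Lev.push h ha hb g.cls = Gen.cls ⟨g.k, g.x ≫ h, g.v, g.w,
      (congrArg (CSet.onVertex h) g.hv).trans ha, (congrArg (CSet.onVertex h) g.hw).trans hb,
      g.σ⟩ := by
  subst ha hb
  exact Lev.map_cls h g

/-- The map on simplices of morphisms between the base vertices. -/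
noncomputable abbrev pushHom {X Y : BiCSet.{u}} (f : X ⟶ Y) {Δ : SimplexCategoryᵒᵖ}
    (t : Lev.of Δ X.a ⟶ Lev.of Δ X.b) : Lev.of Δ Y.a ⟶ Lev.of Δ Y.b :=
  Lev.push f.hom f.map_a f.map_b t

lemma pushHom_comp {X Y Z : BiCSet.{u}} (f : X ⟶ Y) (g : Y ⟶ Z) {Δ : SimplexCategoryᵒᵖ}
    (t : Lev.of Δ X.a ⟶ Lev.of Δ X.b) : pushHom (f ≫ g) t = pushHom g (pushHom f t) :=
  (Lev.push_push _ _ _ _ _ _ t).symm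

lemma pushHom_id {X : BiCSet.{u}} {Δ : SimplexCategoryᵒᵖ} (t : Lev.of Δ X.a ⟶ Lev.of Δ X.b) :
    pushHom (𝟙 X) t = t :=
  Lev.push_id _ _ t

/-- The composite in `X ∨ Y` of simplices of morphisms between the base vertices of `X`
and of `Y`. -/
noncomputable def wedgeMul {X Y : BiCSet.{u}} {Δ : SimplexCategoryᵒᵖ}
    (t : Lev.of Δ X.a ⟶ Lev.of Δ X.b) (t' : Lev.of Δ Y.a ⟶ Lev.of Δ Y.b) :
    Lev.of Δ (wedge X Y).a ⟶ Lev.of Δ (wedge X Y).b :=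
  Lev.push (inl X Y) rfl (glue X Y) t ≫ Lev.push (inr X Y) rfl rfl t'

/-- A map out of `X ∨ Y` acts on a composite factor by factor, through its two restrictions. The
restrictions and all end points are variables tied by equations, so that the lemma applies to
`desc`, `wedgeMap`, the associator and the units alike. -/
lemma push_wedgeMul {X Y : BiCSet.{u}} {Z : CSet.{u}} {k : (wedge X Y).S ⟶ Z}
    {f : X.S ⟶ Z} {g : Y.S ⟶ Z} (hf : inl X Y ≫ k = f) (hg : inr X Y ≫ k = g)
    {a b c : CSet.Vertex Z} (hka : CSet.onVertex k (wedge X Y).a = a)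
    (hkc : CSet.onVertex k (wedge X Y).b = c) (ha : CSet.onVertex f X.a = a)
    (hb : CSet.onVertex f X.b = b) (hb' : CSet.onVertex g Y.a = b) (hc : CSet.onVertex g Y.b = c)
    {Δ : SimplexCategoryᵒᵖ}
    (t : Lev.of Δ X.a ⟶ Lev.of Δ X.b) (t' : Lev.of Δ Y.a ⟶ Lev.of Δ Y.b) :
    Lev.push k hka hkc (wedgeMul t t') = Lev.push f ha hb t ≫ Lev.push g hb' hc t' := by
  subst hf hg
  have hm : CSet.onVertex k (CSet.onVertex (inr X Y) Y.a) = b := hb'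
  exact (Lev.push_mul k hka hm hkc _ _).trans (congrArg₂ (· ≫ ·)
    (Lev.push_push _ _ _ _ _ _ t) (Lev.push_push _ _ _ _ _ _ t'))

lemma pushHom_desc {X Y : BiCSet.{u}} {Z : CSet.{u}} {a b c : CSet.Vertex Z}
    (f : X ⟶ ⟨Z, a, b⟩) (g : Y ⟶ ⟨Z, b, c⟩) {Δ : SimplexCategoryᵒᵖ}
    (t : Lev.of Δ X.a ⟶ Lev.of Δ X.b) (t' : Lev.of Δ Y.a ⟶ Lev.of Δ Y.b) :
    pushHom (desc f g) (wedgeMul t t') =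
      pushHom (Y := ⟨Z, a, b⟩) f t ≫ pushHom (Y := ⟨Z, b, c⟩) g t' :=
  push_wedgeMul (by simp) (by simp) _ _ _ _ _ _ t t'

lemma pushHom_wedgeMap {X X' Y Y' : BiCSet.{u}} (f : X ⟶ X') (g : Y ⟶ Y') {Δ : SimplexCategoryᵒᵖ}
    (t : Lev.of Δ X.a ⟶ Lev.of Δ X.b) (t' : Lev.of Δ Y.a ⟶ Lev.of Δ Y.b) :
    pushHom (wedgeMap f g) (wedgeMul t t') = wedgeMul (pushHom f t) (pushHom g t') := by
  refine (push_wedgeMul (f := f.hom ≫ inl X' Y') (g := g.hom ≫ inr X' Y') (by simp [wedgeMap])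
    (by simp [wedgeMap]) _ _ (congrArg (CSet.onVertex (inl X' Y')) f.map_a)
    ((congrArg (CSet.onVertex (inl X' Y')) f.map_b).trans (glue X' Y'))
    (congrArg (CSet.onVertex (inr X' Y')) g.map_a)
    (congrArg (CSet.onVertex (inr X' Y')) g.map_b) t t').trans ?_
  exact congrArg₂ (· ≫ ·) (Lev.push_push _ _ _ _ _ _ t).symm (Lev.push_push _ _ _ _ _ _ t').symm

/-- The associator restricts to the canonical inclusions of `X`, `Y` and `Z`. Both sides are
therefore composites of the same three simplices, bracketed differently. -/
lemma pushHom_assoc {X Y Z : BiCSet.{u}} {Δ : SimplexCategoryᵒᵖ}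
    (t : Lev.of Δ X.a ⟶ Lev.of Δ X.b) (t' : Lev.of Δ Y.a ⟶ Lev.of Δ Y.b)
    (t'' : Lev.of Δ Z.a ⟶ Lev.of Δ Z.b) :
    pushHom (assoc X Y Z).hom (wedgeMul (wedgeMul t t') t'') = wedgeMul t (wedgeMul t' t'') := by
  have e₁ : CSet.onVertex (inl Y Z ≫ inr X (wedge Y Z)) Y.b =
      CSet.onVertex (inr Y Z ≫ inr X (wedge Y Z)) Z.a :=
    congrArg (CSet.onVertex (inr X (wedge Y Z))) (glue Y Z)
  refine (push_wedgeMul (X := wedge X Y) (Y := Z)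
    (f := glueMap (inl X (wedge Y Z)) (inl Y Z ≫ inr X (wedge Y Z)) (id <| glue X (wedge Y Z)))
    (g := inr Y Z ≫ inr X (wedge Y Z)) (by simp [assoc]) (by simp [assoc]) _ _ (glueMap_a _ _ _)
    ((glueMap_b _ _ _).trans e₁) rfl rfl _ t'').trans ?_
  refine (congrArg (· ≫ _) (push_wedgeMul (X := X) (Y := Y)
    (inl_glueMap (inl X (wedge Y Z)) (inl Y Z ≫ inr X (wedge Y Z)) (id <| glue X (wedge Y Z)))
    (inr_glueMap (inl X (wedge Y Z)) (inl Y Z ≫ inr X (wedge Y Z)) (id <| glue X (wedge Y Z)))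
    _ _ rfl (glue X (wedge Y Z)) rfl e₁ t t')).trans ?_
  refine (Category.assoc _ _ _).trans (congrArg (_ ≫ ·) ?_)
  exact (push_wedgeMul (X := Y) (Y := Z) (k := inr X (wedge Y Z)) rfl rfl rfl rfl rfl e₁ rfl rfl
    t' t'').symm

lemma pushHom_leftUnit {X : BiCSet.{u}} {Δ : SimplexCategoryᵒᵖ} (t : Lev.of Δ X.a ⟶ Lev.of Δ X.b) :
    pushHom (leftUnit X).hom (wedgeMul (X := unit) (𝟙 (Lev.of Δ star)) t) = t := by
  refine (push_wedgeMul (X := unit) (f := CSet.pt X.a) (g := 𝟙 X.S) (by simp [leftUnit])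
    (by simp [leftUnit]) _ _ (CSet.onVertex_pt _) (CSet.onVertex_pt _) rfl rfl _ t).trans ?_
  exact (congrArg₂ (· ≫ ·) (Lev.push_one _ _ _) (Lev.push_id _ _ t)).trans (Category.id_comp t)

lemma pushHom_rightUnit {X : BiCSet.{u}} {Δ : SimplexCategoryᵒᵖ} (t : Lev.of Δ X.a ⟶ Lev.of Δ X.b) :
    pushHom (rightUnit X).hom (wedgeMul (Y := unit) t (𝟙 (Lev.of Δ star))) = t := by
  refine (push_wedgeMul (Y := unit) (f := 𝟙 X.S) (g := CSet.pt X.b) (by simp [rightUnit])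
    (by simp [rightUnit]) _ _ rfl rfl (CSet.onVertex_pt _) (CSet.onVertex_pt _) t _).trans ?_
  exact (congrArg₂ (· ≫ ·) (Lev.push_id _ _ t) (Lev.push_one _ _ _)).trans (Category.comp_id t)

/-! ### Simplices of morphisms of necklaces -/

/-- A simplex of morphisms of a necklace over `X`. -/
abbrev RawNeckLev (X : BiCSet.{u}) (Δ : SimplexCategoryᵒᵖ) : Type u :=
  Σ l : List ℕ+, (neck.{u} l ⟶ X) × (Lev.of Δ (neck.{u} l).a ⟶ Lev.of Δ (neck.{u} l).b)

/-- The relation given by the maps of necklaces over `X`. -/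
def RawNeckLev.Rel {X : BiCSet.{u}} {Δ : SimplexCategoryᵒᵖ} (γ γ' : RawNeckLev X Δ) : Prop :=
  ∃ φ : neck.{u} γ.1 ⟶ neck.{u} γ'.1, γ.2.1 = φ ≫ γ'.2.1 ∧ pushHom φ γ.2.2 = γ'.2.2

/-- The simplices of the colimit of the mapping spaces of the necklaces over `X`. -/
def NeckLev (X : BiCSet.{u}) (Δ : SimplexCategoryᵒᵖ) : Type u := Quot (@RawNeckLev.Rel X Δ)

/-- `X` is isomorphic to some necklace. -/
abbrev IsNeck (X : BiCSet.{u}) : Prop := ∃ l, Nonempty (neck.{u} l ≅ X)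

lemma isNeck_neck (l : List ℕ+) : IsNeck (neck.{u} l) := ⟨l, ⟨Iso.refl _⟩⟩

lemma isNeck_unit : IsNeck BiCSet.unit.{u} := ⟨[], ⟨Iso.refl _⟩⟩

/-- Dimension zero is needed because the interval `[v, v]` is a point. It corresponds to the
necklace without beads, as `□⁰` has a single vertex; a cube of positive dimension is a single bead.
-/
lemma isNeck_cube : ∀ n : ℕ, IsNeck (BiCSet.cube.{u} n)
  | 0 => ⟨[], ⟨eqToIso (by
      change (⟨CubRig.cube 0, star, star⟩ : BiCSet.{u}) = ⟨CubRig.cube 0, _, _⟩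
      congr 1 <;> exact (vertex_cube_zero _).symm)⟩⟩
  | n + 1 => ⟨[n.succPNat], ⟨rightUnit _⟩⟩

lemma isNeck_wedge_neck (l' : List ℕ+) : ∀ l, IsNeck (wedge (neck.{u} l) (neck.{u} l'))
  | [] => ⟨l', ⟨(leftUnit _).symm⟩⟩
  | n :: l => by
    obtain ⟨k, ⟨e⟩⟩ := isNeck_wedge_neck l' l
    exact ⟨n :: k, ⟨wedgeIso (Iso.refl _) e ≪≫ (assoc _ _ _).symm⟩⟩

lemma IsNeck.wedge {X Y : BiCSet.{u}} (hX : IsNeck X) (hY : IsNeck Y) :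
    IsNeck (BiCSet.wedge X Y) := by
  obtain ⟨n, ⟨e⟩⟩ := hX
  obtain ⟨m, ⟨e'⟩⟩ := hY
  obtain ⟨k, ⟨e''⟩⟩ := isNeck_wedge_neck.{u} m n
  exact ⟨k, ⟨e'' ≪≫ wedgeIso e e'⟩⟩

namespace NeckLev

variable {Δ : SimplexCategoryᵒᵖ}

/-- The simplex represented by a map out of a double pointed cubical set that is isomorphic to some
necklace. -/
noncomputable def mk {T : BiCSet.{u}} (hT : IsNeck T) {X : BiCSet.{u}} (f : T ⟶ X)
    (t : Lev.of Δ T.a ⟶ Lev.of Δ T.b) : NeckLev X Δ :=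
  Quot.mk _ ⟨hT.choose, hT.choose_spec.some.hom ≫ f, pushHom hT.choose_spec.some.inv t⟩

/-- Conjugated by the chosen isomorphisms, `h` becomes a map between standard necklaces, so one
instance of the generating relation suffices. In particular the class does not depend on the
isomorphism chosen in `mk`. -/
lemma mk_comp {T T' : BiCSet.{u}} (hT : IsNeck T) (hT' : IsNeck T') {X : BiCSet.{u}} (h : T ⟶ T')
    (f : T' ⟶ X) (t : Lev.of Δ T.a ⟶ Lev.of Δ T.b) :
    mk hT (h ≫ f) t = mk hT' f (pushHom h t) :=
  Quot.sound ⟨hT.choose_spec.some.hom ≫ h ≫ hT'.choose_spec.some.inv, by simp, by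
    simp only [← pushHom_comp, Iso.inv_hom_id_assoc]⟩

lemma quot_mk_eq {X : BiCSet.{u}} (l : List ℕ+) (f : neck.{u} l ⟶ X)
    (t : Lev.of Δ (neck.{u} l).a ⟶ Lev.of Δ (neck.{u} l).b) :
    (Quot.mk _ ⟨l, f, t⟩ : NeckLev X Δ) = mk (isNeck_neck l) f t :=
  Quot.sound ⟨(isNeck_neck l).choose_spec.some.inv, by simp, rfl⟩

lemma ind {X : BiCSet.{u}} {P : NeckLev X Δ → Prop}
    (h : ∀ (l : List ℕ+) (f : neck.{u} l ⟶ X)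
      (t : Lev.of Δ (neck.{u} l).a ⟶ Lev.of Δ (neck.{u} l).b), P (mk (isNeck_neck l) f t))
    (p : NeckLev X Δ) : P p := by
  obtain ⟨⟨l, f, t⟩⟩ := p
  rw [quot_mk_eq]
  exact h l f t

/-- The simplex of the identity of a vertex. -/
noncomputable def one {S : CSet.{u}} (a : CSet.Vertex S) : NeckLev ⟨S, a, a⟩ Δ :=
  mk isNeck_unit (BiCSet.const a) (𝟙 (Lev.of Δ star))

/-- Composition, given by the concatenation of necklaces. -/
noncomputable def mul {S : CSet.{u}} {a b c : CSet.Vertex S} (p : NeckLev ⟨S, a, b⟩ Δ)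
    (q : NeckLev ⟨S, b, c⟩ Δ) : NeckLev ⟨S, a, c⟩ Δ :=
  Quot.liftOn₂ p q
    (fun γ β => mk ((isNeck_neck γ.1).wedge (isNeck_neck β.1)) (desc γ.2.1 β.2.1)
      (wedgeMul γ.2.2 β.2.2))
    (by
      rintro ⟨l, f, t⟩ ⟨m, g, t'⟩ ⟨m', g', t''⟩ ⟨φ, h, ht⟩
      dsimp at φ h ht ⊢
      rw [h, ← ht]
      -- A relation in one factor, wedged with the identity of the other, is a relation between the
      -- concatenations.
      refine Eq.trans ?_ ((mk_comp ((isNeck_neck _).wedge (isNeck_neck _))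
        ((isNeck_neck _).wedge (isNeck_neck _)) (wedgeMap (𝟙 _) φ)
        (desc f g') (wedgeMul t t')).trans ?_)
      · rw [wedgeMap_desc, Category.id_comp]
      · rw [pushHom_wedgeMap, pushHom_id])
    (by
      rintro ⟨l, f, t⟩ ⟨l', f', t''⟩ ⟨m, g, t'⟩ ⟨φ, h, ht⟩
      dsimp at φ h ht ⊢
      rw [h, ← ht]
      refine Eq.trans ?_ ((mk_comp ((isNeck_neck _).wedge (isNeck_neck _))
        ((isNeck_neck _).wedge (isNeck_neck _)) (wedgeMap φ (𝟙 _))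
        (desc f' g) (wedgeMul t t')).trans ?_)
      · rw [wedgeMap_desc, Category.id_comp]
      · rw [pushHom_wedgeMap, pushHom_id])

lemma mul_mk {T T' : BiCSet.{u}} (hT : IsNeck T) (hT' : IsNeck T') {S : CSet.{u}}
    {a b c : CSet.Vertex S} (f : T ⟶ ⟨S, a, b⟩) (g : T' ⟶ ⟨S, b, c⟩)
    (t : Lev.of Δ T.a ⟶ Lev.of Δ T.b) (t' : Lev.of Δ T'.a ⟶ Lev.of Δ T'.b) :
    (mk hT f t).mul (mk hT' g t') = mk (hT.wedge hT') (desc f g) (wedgeMul t t') := by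
  change mk ((isNeck_neck _).wedge (isNeck_neck _)) (desc (_ ≫ f) (_ ≫ g)) (wedgeMul _ _) = _
  rw [← wedgeMap_desc, mk_comp _ (hT.wedge hT'), pushHom_wedgeMap, ← pushHom_comp, ← pushHom_comp,
    Iso.inv_hom_id, Iso.inv_hom_id, pushHom_id, pushHom_id]

lemma one_mul {S : CSet.{u}} {a b : CSet.Vertex S} (p : NeckLev ⟨S, a, b⟩ Δ) :
    (one a).mul p = p := by
  induction p using ind with
  | h l f t =>
    have e : desc (BiCSet.const a) f = (leftUnit _).hom ≫ f := by
      apply hom_ext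
      apply wedge_hom_ext
      · apply CSet.cube_zero_hom_ext
        simp only [desc_hom, inl_glueMap, comp_hom, leftUnit, inl_glueMap_assoc]
        exact (CSet.onVertex_pt a).trans (f.map_a.symm.trans
          (congrArg (CSet.onVertex f.hom) (CSet.onVertex_pt _).symm))
      · simp [leftUnit]
    rw [one, mul_mk, e, mk_comp _ (isNeck_neck l), pushHom_leftUnit]

lemma mul_one {S : CSet.{u}} {a b : CSet.Vertex S} (p : NeckLev ⟨S, a, b⟩ Δ) :
    p.mul (one b) = p := by
  induction p using ind with
  | h l f t =>
    have e : desc f (BiCSet.const b) = (rightUnit _).hom ≫ f := by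
      apply hom_ext
      apply wedge_hom_ext
      · simp [rightUnit]
      · apply CSet.cube_zero_hom_ext
        simp only [desc_hom, inr_glueMap, comp_hom, rightUnit, inr_glueMap_assoc]
        exact (CSet.onVertex_pt b).trans (f.map_b.symm.trans
          (congrArg (CSet.onVertex f.hom) (CSet.onVertex_pt _).symm))
    rw [one, mul_mk, e, mk_comp _ (isNeck_neck l), pushHom_rightUnit]

/-- The two bracketings are related by the associator, which is a map over `S` that carries one
simplex to the other. -/
lemma mul_assoc {S : CSet.{u}} {a b c d : CSet.Vertex S} (p : NeckLev ⟨S, a, b⟩ Δ)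
    (q : NeckLev ⟨S, b, c⟩ Δ) (r : NeckLev ⟨S, c, d⟩ Δ) :
    (p.mul q).mul r = p.mul (q.mul r) := by
  induction p using ind with
  | h l f t =>
  induction q using ind with
  | h l' g t' =>
  induction r using ind with
  | h l'' h t'' =>
    rw [mul_mk, mul_mk, mul_mk, mul_mk, ← assoc_hom_desc, mk_comp, pushHom_assoc]

/-- The map induced by a map of double pointed cubical sets. -/
noncomputable def map {X Y : BiCSet.{u}} (h : X ⟶ Y) (p : NeckLev X Δ) : NeckLev Y Δ :=
  Quot.map (fun γ => ⟨γ.1, γ.2.1 ≫ h, γ.2.2⟩)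
    (by
      rintro γ γ' ⟨φ, e, e'⟩
      exact ⟨φ, by simp [e], e'⟩) p

lemma map_mk {T X Y : BiCSet.{u}} (hT : IsNeck T) (h : X ⟶ Y) (f : T ⟶ X)
    (t : Lev.of Δ T.a ⟶ Lev.of Δ T.b) : (mk hT f t).map h = mk hT (f ≫ h) t := by
  change Quot.mk _ (⟨_, (_ ≫ f) ≫ h, _⟩ : RawNeckLev _ _) = Quot.mk _ _
  rw [Category.assoc]

/-- The comparison with the mapping space of `X`. -/
noncomputable def toLev {X : BiCSet.{u}} (p : NeckLev X Δ) : Lev.of Δ X.a ⟶ Lev.of Δ X.b :=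
  Quot.lift (fun γ => pushHom γ.2.1 γ.2.2)
    (by
      rintro ⟨l, f, t⟩ ⟨l', f', t'⟩ ⟨φ, e, ht⟩
      dsimp at φ e ht ⊢
      subst e ht
      exact pushHom_comp φ f' t) p

lemma toLev_mk {T X : BiCSet.{u}} (hT : IsNeck T) (f : T ⟶ X)
    (t : Lev.of Δ T.a ⟶ Lev.of Δ T.b) : (mk hT f t).toLev = pushHom f t := by
  change pushHom (_ ≫ f) (pushHom _ t) = _
  rw [← pushHom_comp, Iso.inv_hom_id_assoc]

lemma toLev_one {S : CSet.{u}} (a : CSet.Vertex S) : (one (Δ := Δ) a).toLev = 𝟙 (Lev.of Δ a) :=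
  (toLev_mk _ _ _).trans (Lev.push_one _ _ _)

lemma toLev_mul {S : CSet.{u}} {a b c : CSet.Vertex S} (p : NeckLev ⟨S, a, b⟩ Δ)
    (q : NeckLev ⟨S, b, c⟩ Δ) :
    (p.mul q).toLev = (show Lev.of Δ a ⟶ Lev.of Δ b from p.toLev) ≫
      (show Lev.of Δ b ⟶ Lev.of Δ c from q.toLev) := by
  induction p using ind with
  | h l f t =>
  induction q using ind with
  | h l' g t' =>
    rw [mul_mk, toLev_mk, toLev_mk, toLev_mk]
    exact pushHom_desc f g t t'

end NeckLev

variable {Δ : SimplexCategoryᵒᵖ}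

/-! ### Simplices of morphisms of a cube -/

lemma vertexVal_le_of_hom {k : Box} {v w : CSet.Vertex (yo.{u}.obj k)} {T : BiCSet.{u}}
    (hT : IsNeck T) (f : T ⟶ ⟨yo.{u}.obj k, v, w⟩) : vertexVal v ≤ vertexVal w := by
  obtain ⟨l, ⟨e⟩⟩ := hT
  have h := (neck_hom_cube l (e.hom ≫ f).hom).1
  rwa [(e.hom ≫ f).map_a, (e.hom ≫ f).map_b] at h

lemma hom_comp_eq_of_fixed {k : Box} {v w : CSet.Vertex (yo.{u}.obj k)} {T : BiCSet.{u}}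
    (hT : IsNeck T) (f : T ⟶ ⟨yo.{u}.obj k, v, w⟩) (e : k ⟶ k)
    (he : ∀ x, vertexVal v ≤ x → x ≤ vertexVal w → e.toFun x = x) :
    f.hom ≫ yo.map e = f.hom := by
  obtain ⟨l, ⟨i⟩⟩ := hT
  have h := (neck_hom_cube l (i.hom ≫ f).hom).2 e
  rw [(i.hom ≫ f).map_a, (i.hom ≫ f).map_b] at h
  have hf : f.hom = i.inv.hom ≫ (i.hom ≫ f).hom :=
    congrArg BiCSet.Hom.hom (Iso.inv_hom_id_assoc i f).symm
  rw [hf, Category.assoc, h he]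

lemma isNeck_spine (n : ℕ) : IsNeck (spine.{u} n) := isNeck_neck _

lemma CPath.vertexVal_le {k : Box} {v w : CSet.Vertex (yo.{u}.obj k)}
    (p : CPath (yo.{u}.obj k) v w) : vertexVal v ≤ vertexVal w := by
  induction p using CPath.ind with
  | h n f => exact vertexVal_le_of_hom (isNeck_spine n) f

/-- Heterogeneous equality is used because an endomorphism of a cube that fixes `v` and `w` does so
only propositionally, which changes the type of the paths. -/
lemma CPath.mk_heq {X : BiCSet.{u}} (hX : IsSpine X) {S : CSet.{u}} {a b a' b' : CSet.Vertex S}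
    (ha : a = a') (hb : b = b') {f : X ⟶ ⟨S, a, b⟩} {f' : X ⟶ ⟨S, a', b'⟩} (h : f.hom = f'.hom) :
    HEq (CPath.mk hX f) (CPath.mk hX f') := by
  subst ha hb
  obtain rfl : f = f' := hom_ext h
  rfl

/-- A path is represented by a map from the necklace `I_n`, which stays in the interval between its
end points, where `e` acts as the identity. -/
lemma CPath.map_heq_of_fixed {k : Box} {v w : CSet.Vertex (yo.{u}.obj k)}
    (p : CPath (yo.{u}.obj k) v w) (e : k ⟶ k)
    (he : ∀ x, vertexVal v ≤ x → x ≤ vertexVal w → e.toFun x = x) :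
    HEq (p.map (yo.map e)) p := by
  have hv : CSet.onVertex (yo.map e) v = v :=
    vertexVal_injective (he _ le_rfl p.vertexVal_le)
  have hw : CSet.onVertex (yo.map e) w = w :=
    vertexVal_injective (he _ p.vertexVal_le le_rfl)
  induction p using CPath.ind with
  | h n f =>
    rw [CPath.map_mk]
    exact CPath.mk_heq _ hv hw (hom_comp_eq_of_fixed (isNeck_spine n) f e he)

/-- A simplex of the nerve has at least its vertex `0`, which is a path from `v` to `w`, and paths
in a cube ascend. -/
lemma Gen.vertexVal_le {S : CSet.{u}} {a b : CSet.Vertex S} (g : Gen S Δ a b) :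
    vertexVal g.v ≤ vertexVal g.w :=
  CPath.vertexVal_le
    ((show ComposableArrows (CPath (yo.{u}.obj g.k) g.v g.w) (unop Δ).len from g.σ).obj 0)

/-- Paths form a preorder, so a simplex of the nerve is determined by its vertices. -/
lemma Gen.cls_congr {S : CSet.{u}} {a b : CSet.Vertex S} {k : Box} (x : yo.{u}.obj k ⟶ S)
    {v w v' w' : CSet.Vertex (yo.{u}.obj k)} (hv : v = v') (hw : w = w')
    (hva : CSet.onVertex x v = a) (hwb : CSet.onVertex x w = b)
    (hva' : CSet.onVertex x v' = a) (hwb' : CSet.onVertex x w' = b)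
    (σ : ComposableArrows (CPath (yo.{u}.obj k) v w) (unop Δ).len)
    (σ' : ComposableArrows (CPath (yo.{u}.obj k) v' w') (unop Δ).len)
    (h : ∀ i, HEq (σ.obj i) (σ'.obj i)) :
    Gen.cls (Δ := Δ) ⟨k, x, v, w, hva, hwb, σ⟩ = Gen.cls ⟨k, x, v', w', hva', hwb', σ'⟩ := by
  subst hv hw
  obtain rfl : σ = σ' := preorder_functor_ext (fun i => eq_of_heq (h i))
  rfl

/-- The naturality relation moves `e` from the cube to the simplex of paths, and there it does
nothing because all these paths lie in the interval. -/
lemma Gen.cls_eq_of_fixed {S : CSet.{u}} {a b : CSet.Vertex S} (g : Gen S Δ a b) (e : g.k ⟶ g.k)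
    (he : ∀ x, vertexVal g.v ≤ x → x ≤ vertexVal g.w → e.toFun x = x)
    (hv : CSet.onVertex (yo.map e ≫ g.x) g.v = a) (hw : CSet.onVertex (yo.map e ≫ g.x) g.w = b) :
    Gen.cls ⟨g.k, yo.map e ≫ g.x, g.v, g.w, hv, hw, g.σ⟩ = g.cls := by
  refine (Gen.cls_nat e g.x g.v g.w hv hw g.σ).trans ?_
  have hv' : CSet.onVertex (yo.map e) g.v = g.v := vertexVal_injective (he _ le_rfl g.vertexVal_le)
  have hw' : CSet.onVertex (yo.map e) g.w = g.w := vertexVal_injective (he _ g.vertexVal_le le_rfl)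
  exact Gen.cls_congr g.x hv' hw' hv hw g.hv g.hw _ g.σ
    (fun i => CPath.map_heq_of_fixed _ e he)

/-! ### Generators as simplices of one-bead necklaces -/

namespace IntervalRetract

variable {k : Box} {v w : CSet.Vertex (yo.{u}.obj k)} (R : IntervalRetract v w)

/-- The inclusion of the interval, as a double pointed map. -/
def incl : BiCSet.cube.{u} R.d ⟶ ⟨yo.{u}.obj k, v, w⟩ := ⟨yo.map R.ι, R.ι_least, R.ι_greatest⟩

/-- The retraction onto the interval, as a double pointed map. -/
def retr : (⟨yo.{u}.obj k, v, w⟩ : BiCSet.{u}) ⟶ BiCSet.cube.{u} R.d :=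
  ⟨yo.map R.π, R.π_least, R.π_greatest⟩

/-- Every map from a necklace to the cube with end points `v` and `w` factors through the interval,
by way of the retraction. -/
lemma hom_retr_incl {T : BiCSet.{u}} (hT : IsNeck T) (f : T ⟶ ⟨yo.{u}.obj k, v, w⟩) :
    (f ≫ R.retr) ≫ R.incl = f := by
  apply hom_ext
  have h := hom_comp_eq_of_fixed hT f (R.π ≫ R.ι) R.fixed
  rw [Functor.map_comp] at h
  exact (Category.assoc _ _ _).trans h

end IntervalRetract

lemma BiCSet.desc_comp {X Y : BiCSet.{u}} {Z Z' : CSet.{u}} {a b c : CSet.Vertex Z}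
    {a' b' c' : CSet.Vertex Z'} (f : X ⟶ ⟨Z, a, b⟩) (g : Y ⟶ ⟨Z, b, c⟩) (h : Z ⟶ Z')
    (ha : CSet.onVertex h a = a') (hb : CSet.onVertex h b = b') (hc : CSet.onVertex h c = c') :
    desc f g ≫ (⟨h, ha, hc⟩ : BiCSet.Hom ⟨Z, a, c⟩ ⟨Z', a', c'⟩) =
      desc (f ≫ (⟨h, ha, hb⟩ : BiCSet.Hom ⟨Z, a, b⟩ ⟨Z', a', b'⟩))
        (g ≫ (⟨h, hb, hc⟩ : BiCSet.Hom ⟨Z, b, c⟩ ⟨Z', b', c'⟩)) := by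
  apply hom_ext
  apply wedge_hom_ext <;> simp

namespace Gen

variable {S : CSet.{u}} {a b : CSet.Vertex S} (g : Gen S Δ a b)

/-- The cube of a generator, as a double pointed map. -/
def hom : (⟨yo.{u}.obj g.k, g.v, g.w⟩ : BiCSet.{u}) ⟶ ⟨S, a, b⟩ := ⟨g.x, g.hv, g.hw⟩

/-- The generator of the cube itself from which a generator is induced. -/
def univ : Lev.of Δ g.v ⟶ Lev.of Δ g.w := Gen.cls ⟨g.k, 𝟙 _, g.v, g.w, rfl, rfl, g.σ⟩

lemma pushHom_hom_univ : pushHom g.hom g.univ = g.cls :=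
  Lev.push_cls _ _ _ _

/-- Retracting and including again replaces the identity cube by the idempotent `R.π ≫ R.ι`, which
fixes the interval, so `Gen.cls_eq_of_fixed` applies. -/
lemma pushHom_incl_retr (R : IntervalRetract g.v g.w) :
    pushHom R.incl (pushHom R.retr g.univ) = g.univ := by
  refine (pushHom_comp R.retr R.incl g.univ).symm.trans ((Lev.push_cls _ _ _ _).trans ?_)
  have hx : (𝟙 (yo.{u}.obj g.k) ≫ (R.retr ≫ R.incl).hom) = yo.map (R.π ≫ R.ι) ≫ 𝟙 _ := by
    rw [Category.id_comp, Category.comp_id, Functor.map_comp]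
    rfl
  -- The cube is made a variable because the end point proofs stored in the generator depend on it.
  have key : ∀ (y : yo.{u}.obj g.k ⟶ yo.{u}.obj g.k) (_ : y = yo.map (R.π ≫ R.ι) ≫ 𝟙 _)
      (hv : CSet.onVertex y g.v = g.v) (hw : CSet.onVertex y g.w = g.w),
      Gen.cls (Δ := Δ) ⟨g.k, y, g.v, g.w, hv, hw, g.σ⟩ = g.univ := by
    rintro _ rfl hv hw
    exact Gen.cls_eq_of_fixed (⟨g.k, 𝟙 _, g.v, g.w, rfl, rfl, g.σ⟩ : Gen _ Δ g.v g.w) (R.π ≫ R.ι)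
      R.fixed hv hw
  exact key _ hx _ _

/-- A retraction of the cube of a generator onto the interval between its end points. -/
noncomputable def retract : IntervalRetract g.v g.w :=
  (nonempty_intervalRetract g.v g.w g.vertexVal_le).some

/-- The simplex of a necklace with one bead, or none, that represents a generator. -/
noncomputable def toNeckLev : NeckLev ⟨S, a, b⟩ Δ :=
  NeckLev.mk (isNeck_cube _) (g.retract.incl ≫ g.hom) (pushHom g.retract.retr g.univ)

/-- The heart of the argument: any necklace in the cube with a simplex lying over `g.univ`
represents the same class. Since `h` factors through the interval, `h ≫ retr` is a map over `S` to
the chosen representative, and it sends `t` to the retraction of `g.univ`. -/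
lemma mk_eq_toNeckLev {T : BiCSet.{u}} (hT : IsNeck T) (h : T ⟶ ⟨yo.{u}.obj g.k, g.v, g.w⟩)
    (t : Lev.of Δ T.a ⟶ Lev.of Δ T.b) (ht : pushHom h t = g.univ) :
    NeckLev.mk hT (h ≫ g.hom) t = g.toNeckLev := by
  rw [← g.retract.hom_retr_incl hT h, Category.assoc, NeckLev.mk_comp hT (isNeck_cube _),
    pushHom_comp, ht]
  rfl

/-- The constant necklace at `v` carries the identity, so `mk_eq_toNeckLev` identifies it with the
chosen representative. -/
lemma toNeckLev_one (k : Box) (x : yo.{u}.obj k ⟶ S) (v : CSet.Vertex (yo.{u}.obj k))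
    (hv : CSet.onVertex x v = a) :
    toNeckLev ⟨k, x, v, v, hv, hv, (cubeCat.obj k).one v Δ⟩ = NeckLev.one a := by
  refine (mk_eq_toNeckLev _ isNeck_unit (BiCSet.const v) (𝟙 (Lev.of Δ star)) ?_).symm.trans ?_
  · exact (Lev.push_one _ _ _).trans (Gen.cls_one k (𝟙 _) v rfl).symm
  · exact congrArg (fun f => NeckLev.mk isNeck_unit f (𝟙 (Lev.of Δ star))) unit_hom_ext

lemma toNeckLev_mul {c : CSet.Vertex S} (k : Box) (x : yo.{u}.obj k ⟶ S)
    (v w z : CSet.Vertex (yo.{u}.obj k)) (hv : CSet.onVertex x v = a)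
    (hw : CSet.onVertex x w = b) (hz : CSet.onVertex x z = c)
    (σ : ((cubeCat.obj k).hom v w).obj Δ) (τ : ((cubeCat.obj k).hom w z).obj Δ) :
    (toNeckLev ⟨k, x, v, w, hv, hw, σ⟩).mul (toNeckLev ⟨k, x, w, z, hw, hz, τ⟩) =
      toNeckLev ⟨k, x, v, z, hv, hz, (cubeCat.obj k).mul σ τ⟩ := by
  let g₁ : Gen S Δ a b := ⟨k, x, v, w, hv, hw, σ⟩
  let g₂ : Gen S Δ b c := ⟨k, x, w, z, hw, hz, τ⟩
  let g₃ : Gen S Δ a c := ⟨k, x, v, z, hv, hz, (cubeCat.obj k).mul σ τ⟩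
  have hu : g₁.univ ≫ g₂.univ = g₃.univ := Gen.cls_mul k (𝟙 _) v w z rfl rfl rfl σ τ
  -- The wedge of the cubes for `[v, w]` and `[w, z]` maps to the cube from `v` to `z`. Its
  -- composite simplex lies over the composite of the two universal simplices, as required by
  -- `mk_eq_toNeckLev`.
  have ht : pushHom (desc (v := w) g₁.retract.incl g₂.retract.incl)
      (wedgeMul (pushHom g₁.retract.retr g₁.univ) (pushHom g₂.retract.retr g₂.univ)) = g₃.univ := by
    refine (pushHom_desc (b := w) g₁.retract.incl g₂.retract.incl _ _).trans (Eq.trans ?_ hu)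
    exact congrArg₂ (fun (s : Lev.of Δ v ⟶ Lev.of Δ w) (t : Lev.of Δ w ⟶ Lev.of Δ z) => s ≫ t)
      (g₁.pushHom_incl_retr g₁.retract) (g₂.pushHom_incl_retr g₂.retract)
  refine Eq.trans ?_ (g₃.mk_eq_toNeckLev ((isNeck_cube _).wedge (isNeck_cube _)) _ _ ht)
  refine (NeckLev.mul_mk (isNeck_cube _) (isNeck_cube _) _ _ _ _).trans ?_
  exact congrArg (fun f => NeckLev.mk ((isNeck_cube _).wedge (isNeck_cube _)) f _)
    (BiCSet.desc_comp g₁.retract.incl g₂.retract.incl x hv hw hz).symm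

lemma toNeckLev_nat {k k' : Box} (φ : k ⟶ k') (x : yo.{u}.obj k' ⟶ S)
    (v w : CSet.Vertex (yo.{u}.obj k)) (hv : CSet.onVertex (yo.map φ ≫ x) v = a)
    (hw : CSet.onVertex (yo.map φ ≫ x) w = b) (σ : ((cubeCat.obj k).hom v w).obj Δ) :
    toNeckLev ⟨k, yo.map φ ≫ x, v, w, hv, hw, σ⟩ =
      toNeckLev ⟨k', x, CSet.onVertex (yo.map φ) v, CSet.onVertex (yo.map φ) w, hv, hw,
        SCat.mapSimplex (cubeCat.map φ) σ⟩ := by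
  let g : Gen S Δ a b := ⟨k, yo.map φ ≫ x, v, w, hv, hw, σ⟩
  let g' : Gen S Δ a b := ⟨k', x, CSet.onVertex (yo.map φ) v, CSet.onVertex (yo.map φ) w, hv, hw,
    SCat.mapSimplex (cubeCat.map φ) σ⟩
  -- The map `φ` need not carry the interval of `g` onto that of `g'`. The former, mapped to the
  -- larger cube by `φ`, is still a necklace that carries the universal simplex of `g'`.
  refine Eq.trans ?_ (g'.mk_eq_toNeckLev (isNeck_cube _) (g.retract.incl ≫ ofMap (yo.map φ) v w)
    (pushHom g.retract.retr g.univ) ?_)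
  · rfl
  · refine (pushHom_comp _ _ _).trans ((congrArg _ (g.pushHom_incl_retr _)).trans ?_)
    refine (Lev.push_cls _ _ _ _).trans ?_
    exact Gen.cls_nat φ (𝟙 _) v w rfl rfl σ

lemma toLev_toNeckLev : g.toNeckLev.toLev = g.cls := by
  refine (NeckLev.toLev_mk _ _ _).trans ((pushHom_comp _ _ _).trans ?_)
  exact (congrArg _ (g.pushHom_incl_retr _)).trans g.pushHom_hom_univ

end Gen

/-! ### The comparison -/

/-- The vertices of `S`, as the objects of the category of simplices of necklaces over `S`. -/
structure NeckObj (S : CSet.{u}) (Δ : SimplexCategoryᵒᵖ) : Type u where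
  /-- the vertex -/
  as : CSet.Vertex S

noncomputable instance (S : CSet.{u}) (Δ : SimplexCategoryᵒᵖ) : Category (NeckObj S Δ) where
  Hom x y := NeckLev ⟨S, x.as, y.as⟩ Δ
  id x := NeckLev.one x.as
  comp f g := NeckLev.mul f g
  id_comp f := NeckLev.one_mul f
  comp_id f := NeckLev.mul_one f
  assoc f g h := NeckLev.mul_assoc f g h

/-- The functor that represents simplices of morphisms of `S` by necklaces. -/
noncomputable def neckFunctor (S : CSet.{u}) (Δ : SimplexCategoryᵒᵖ) : Lev S Δ ⥤ NeckObj S Δ :=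
  Lev.lift (fun a => ⟨a⟩) (fun g => g.toNeckLev) Gen.toNeckLev_one Gen.toNeckLev_mul
    Gen.toNeckLev_nat

/-- The necklace representation of a simplex of morphisms. -/
noncomputable def Lev.toNeckLev {S : CSet.{u}} {a b : CSet.Vertex S}
    (t : Lev.of Δ a ⟶ Lev.of Δ b) : NeckLev ⟨S, a, b⟩ Δ :=
  (neckFunctor S Δ).map t

lemma Lev.toNeckLev_cls {S : CSet.{u}} {a b : CSet.Vertex S} (g : Gen S Δ a b) :
    Lev.toNeckLev g.cls = g.toNeckLev :=
  Lev.lift_cls (D := NeckObj S Δ) _ _ _ _ _ g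

/-- Both sides respect identities and composition, so it suffices to compare them on generators. -/
lemma Lev.toLev_toNeckLev {S : CSet.{u}} {a b : CSet.Vertex S} (t : Lev.of Δ a ⟶ Lev.of Δ b) :
    (Lev.toNeckLev t).toLev = t := by
  refine Lev.hom_ext (o := fun a => Lev.of Δ a) (fun t => (Lev.toNeckLev t).toLev) (fun t => t)
    (fun a => ?_) (fun f g => ?_) (fun _ => rfl) (fun _ _ => rfl) (fun g => ?_) t
  · exact (congrArg NeckLev.toLev ((neckFunctor S Δ).map_id (Lev.of Δ a))).trans
      (NeckLev.toLev_one a)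
  · exact (congrArg NeckLev.toLev ((neckFunctor S Δ).map_comp f g)).trans (NeckLev.toLev_mul _ _)
  · exact (congrArg NeckLev.toLev (Lev.toNeckLev_cls g)).trans g.toLev_toNeckLev

/-! ### Naturality of the necklace representation -/

lemma NeckLev.map_mul {S S' : CSet.{u}} (h : S ⟶ S') {a b c : CSet.Vertex S}
    (p : NeckLev ⟨S, a, b⟩ Δ) (q : NeckLev ⟨S, b, c⟩ Δ) :
    (p.mul q).map (ofMap h a c) = (p.map (ofMap h a b)).mul (q.map (ofMap h b c)) := by
  induction p using NeckLev.ind with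
  | h l f t =>
  induction q using NeckLev.ind with
  | h l' g t' =>
    rw [mul_mk, map_mk, map_mk, map_mk, mul_mk]
    congr 1
    apply BiCSet.hom_ext
    apply wedge_hom_ext <;> simp

lemma NeckLev.map_one {S S' : CSet.{u}} (h : S ⟶ S') (a : CSet.Vertex S) :
    (one (Δ := Δ) a).map (ofMap h a a) = one (CSet.onVertex h a) := by
  rw [one, map_mk]
  exact congrArg (fun f => mk isNeck_unit f (𝟙 (Lev.of Δ star))) unit_hom_ext

/-- The interval, its retraction and the universal simplex depend on the cube's vertices and paths
but not on its map to `S`, so only the structure map changes. -/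
lemma Gen.toNeckLev_map {S S' : CSet.{u}} (h : S ⟶ S') {a b : CSet.Vertex S} (g : Gen S Δ a b) :
    (g.map h).toNeckLev = g.toNeckLev.map (ofMap h a b) :=
  (NeckLev.map_mk _ _ _ _).symm

lemma Lev.toNeckLev_map {S S' : CSet.{u}} (h : S ⟶ S') {a b : CSet.Vertex S}
    (t : Lev.of Δ a ⟶ Lev.of Δ b) :
    Lev.toNeckLev ((Lev.map h Δ).map t) = (Lev.toNeckLev t).map (ofMap h a b) := by
  refine Lev.hom_ext (D := NeckObj S' Δ) (o := fun a => ⟨CSet.onVertex h a⟩)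
    (fun t => Lev.toNeckLev ((Lev.map h Δ).map t))
    (fun {a b} t => (Lev.toNeckLev t).map (ofMap h a b))
    (fun a => (Lev.map h Δ ⋙ neckFunctor S' Δ).map_id (Lev.of Δ a))
    (fun f g => (Lev.map h Δ ⋙ neckFunctor S' Δ).map_comp f g)
    (fun a => ?_) (fun f g => ?_) (fun {a b} g => ?_) t
  · exact (congrArg (NeckLev.map (ofMap h a a)) ((neckFunctor S Δ).map_id (Lev.of Δ a))).trans
      (NeckLev.map_one h a)
  · exact (congrArg (NeckLev.map _) ((neckFunctor S Δ).map_comp f g)).trans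
      (NeckLev.map_mul h _ _)
  · exact (congrArg (fun t => Lev.toNeckLev t) (Lev.map_cls h g)).trans
      ((Lev.toNeckLev_cls _).trans ((Gen.toNeckLev_map h g).trans
        (congrArg (NeckLev.map (ofMap h a b)) (Lev.toNeckLev_cls g).symm)))

lemma Lev.toNeckLev_pushHom {X Y : BiCSet.{u}} (f : X ⟶ Y) (t : Lev.of Δ X.a ⟶ Lev.of Δ X.b) :
    Lev.toNeckLev (pushHom f t) = (Lev.toNeckLev t).map f := by
  obtain ⟨S', a', b'⟩ := Y
  obtain ⟨f, ha, hb⟩ := f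
  dsimp only at ha hb f
  subst ha hb
  exact Lev.toNeckLev_map f t

/-- The structure map `f` of a necklace over `neck l` is itself a map of necklaces over `neck l`,
with target the identity, and it sends `t` to `pushHom f t`. -/
lemma NeckLev.eq_mk_id_toLev (l : List ℕ+) (p : NeckLev (neck.{u} l) Δ) :
    p = mk (isNeck_neck l) (𝟙 _) p.toLev := by
  induction p using NeckLev.ind with
  | h l' f t => rw [toLev_mk, ← mk_comp (isNeck_neck l'), Category.comp_id]

/-- Every simplex of a necklace over `X` is the representation of its image. -/
lemma NeckLev.toNeckLev_toLev {X : BiCSet.{u}} (p : NeckLev X Δ) : Lev.toNeckLev p.toLev = p := by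
  induction p using NeckLev.ind with
  | h l f t =>
    -- Over the necklace itself, the representation of `t` is the identity with the simplex
    -- `(Lev.toNeckLev t).toLev`, which is `t`. Naturality along `f` then gives the general case.
    have h := eq_mk_id_toLev l (Lev.toNeckLev t)
    rw [Lev.toLev_toNeckLev] at h
    refine (congrArg (fun t => Lev.toNeckLev t) (toLev_mk _ f t)).trans
      ((Lev.toNeckLev_pushHom f t).trans ?_)
    refine (congrArg (map f) h).trans ?_
    rw [map_mk, Category.id_comp]

/-! ### Passage to the categorical colimit -/

/-- A necklace over `X`. -/
noncomputable def neckOver {X : BiCSet.{u}} (l : List ℕ+) (f : neck.{u} l ⟶ X) :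
    CostructuredArrow necIncl.{u} X :=
  CostructuredArrow.mk (S := necIncl.{u}) (Y := (show Nec.{u} from l)) f

/-- A map of necklaces over `X`. -/
noncomputable def neckOverMap {X : BiCSet.{u}} {l l' : List ℕ+} (φ : neck.{u} l ⟶ neck.{u} l')
    (f : neck.{u} l' ⟶ X) : neckOver l (φ ≫ f) ⟶ neckOver l' f :=
  CostructuredArrow.homMk (InducedCategory.homMk φ) rfl

/-- The simplex of the colimit that is represented by a simplex of a necklace. -/
noncomputable def EtMk {X : BiCSet.{u}} (l : List ℕ+) (f : neck.{u} l ⟶ X)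
    (t : Lev.of Δ (neck.{u} l).a ⟶ Lev.of Δ (neck.{u} l).b) : (Et.obj X).obj Δ :=
  (colimit.ι (neckDiagram X) (neckOver l f)).app Δ t

/-- This is the cocone identity for `φ`, seen as a map of necklaces over `X`; it lets the quotient
`NeckLev` map to the colimit. -/
lemma EtMk_comp {X : BiCSet.{u}} {l l' : List ℕ+} (φ : neck.{u} l ⟶ neck.{u} l')
    (f : neck.{u} l' ⟶ X) (t : Lev.of Δ (neck.{u} l).a ⟶ Lev.of Δ (neck.{u} l).b) :
    EtMk l (φ ≫ f) t = EtMk l' f (pushHom φ t) := by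
  have h := congrArg (fun m => m.app Δ t) (colimit.w (neckDiagram X) (neckOverMap φ f))
  exact h.symm.trans (congrArg ((colimit.ι (neckDiagram X) (neckOver l' f)).app Δ)
    (CtMap_app_apply φ t))

/-- Colimits of simplicial sets are computed degreewise, and a colimit of sets is covered by its
summands. -/
lemma EtMk_surjective {X : BiCSet.{u}} (z : (Et.obj X).obj Δ) :
    ∃ (l : List ℕ+) (f : neck.{u} l ⟶ X)
      (t : Lev.of Δ (neck.{u} l).a ⟶ Lev.of Δ (neck.{u} l).b), EtMk l f t = z := by
  obtain ⟨T, t, h⟩ := Types.jointly_surjective _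
    (isColimitOfPreserves ((evaluation _ _).obj Δ) (colimit.isColimit (neckDiagram X))) z
  exact ⟨T.left, T.hom, t, h⟩

/-- The map from simplices of necklaces over `X` to the colimit. -/
noncomputable def NeckLev.toEt {X : BiCSet.{u}} (p : NeckLev X Δ) : (Et.obj X).obj Δ :=
  Quot.lift (fun γ : RawNeckLev X Δ => EtMk γ.1 γ.2.1 γ.2.2)
    (by
      rintro ⟨l, f, t⟩ ⟨l', f', t'⟩ ⟨φ, e, ht⟩
      dsimp at φ e ht ⊢
      subst e ht
      exact EtMk_comp φ f' t) p

/-- The comparison map `E_t → 𝔆^□_t`. -/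
noncomputable def EtDesc : Et.{u} ⟶ Ct.{u} :=
  Functor.descOfIsLeftKanExtension (L := necIncl.{u}) (F := necIncl.{u} ⋙ Ct.{u})
    (Functor.pointwiseLeftKanExtension necIncl.{u} (necIncl.{u} ⋙ Ct.{u}))
    (Functor.pointwiseLeftKanExtensionUnit necIncl.{u} (necIncl.{u} ⋙ Ct.{u})) Ct.{u} (𝟙 _)

/-- `EtDesc` is induced by the identity transformation on necklaces, so only the map given by the
structure map of `T` remains. Naturality in `X` is part of the Kan extension. -/
lemma ι_EtDesc (X : BiCSet.{u}) (T : CostructuredArrow necIncl.{u} X) :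
    colimit.ι (neckDiagram X) T ≫ EtDesc.app X = Ct.map T.hom := by
  refine (congrArg (colimit.ι (neckDiagram X) T ≫ ·) (Functor.pointwiseLeftKanExtension_desc_app
    necIncl.{u} (necIncl.{u} ⋙ Ct.{u}) Ct.{u} (𝟙 _) X)).trans ?_
  refine (colimit.ι_desc _ _).trans ?_
  exact Category.id_comp _

/-- The comparison map on simplices. -/
noncomputable def EtToLev {X : BiCSet.{u}} (z : (Et.obj X).obj Δ) : Lev.of Δ X.a ⟶ Lev.of Δ X.b :=
  (EtDesc.app X).app Δ z

lemma EtToLev_mk {X : BiCSet.{u}} (l : List ℕ+) (f : neck.{u} l ⟶ X)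
    (t : Lev.of Δ (neck.{u} l).a ⟶ Lev.of Δ (neck.{u} l).b) :
    EtToLev (EtMk l f t) = pushHom f t :=
  (congrArg (fun m => m.app Δ t) (ι_EtDesc X (neckOver l f))).trans (CtMap_app_apply f t)

lemma EtToLev_bijective (X : BiCSet.{u}) (Δ : SimplexCategoryᵒᵖ) :
    Function.Bijective (EtToLev (X := X) (Δ := Δ)) := by
  refine Function.bijective_iff_has_inverse.2
    ⟨fun t => (Lev.toNeckLev (a := X.a) (b := X.b) t).toEt, fun z => ?_, fun t => ?_⟩
  · obtain ⟨l, f, t, rfl⟩ := EtMk_surjective z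
    -- The image of `EtMk l f t` is also the image of the class of `(l, f, t)` in `NeckLev`. The
    -- necklace representation recovers this class, and `NeckLev.toEt` sends it back to `EtMk l f
    -- t`.
    have e := (EtToLev_mk l f t).trans (NeckLev.toLev_mk (isNeck_neck l) f t).symm
    refine (congrArg (fun t => NeckLev.toEt (Lev.toNeckLev (a := X.a) (b := X.b) t)) e).trans ?_
    refine (congrArg NeckLev.toEt (NeckLev.toNeckLev_toLev _)).trans ?_
    rw [← NeckLev.quot_mk_eq]
    rfl
  · have h : ∀ p : NeckLev X Δ, EtToLev p.toEt = p.toLev := by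
      rintro ⟨l, f, t⟩
      exact EtToLev_mk l f t
    exact (h _).trans (Lev.toLev_toNeckLev t)

instance (X : BiCSet.{u}) : IsIso (EtDesc.{u}.app X) := by
  have (Δ : SimplexCategoryᵒᵖ) : IsIso ((EtDesc.{u}.app X).app Δ) :=
    (isIso_iff_bijective _).2 (EtToLev_bijective X Δ)
  exact NatIso.isIso_of_isIso_app _

end CubRig

theorem theoremT : ∃ α : Et.{u} ≅ Ct.{u}, ∀ (S : CSet.{u}) (a b : CSet.Vertex S)
    (T : CostructuredArrow necIncl.{u} ⟨S, a, b⟩),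
    colimit.ι (neckDiagram ⟨S, a, b⟩) T ≫ α.hom.app ⟨S, a, b⟩ = Ct.map T.hom := by
  have : IsIso EtDesc.{u} := NatIso.isIso_of_isIso_app _
  exact ⟨asIso EtDesc, fun S a b T => ι_EtDesc ⟨S, a, b⟩ T⟩
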